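/- **Lemma 1.2.** Let $m\ge 1$ and $m\le q\le 2m$ be integers. For $0\le p\le m$ let $$Y_p=\{\lambda\in\mathbb R^m:\lambda_1>\cdots>\lambda_p>0>\lambda_{p+1}>\cdots>\lambda_m\},$$ let $\Delta(\lambda)=\prod_{1\le i<j\le m}(\lambda_i-\lambda_j)$, let $D(\lambda)$ be the diagonal matrix with diagonal entries $\lambda_1,\dots,\lambda_m$, and for $m\times m$ matrices $P$ put $$F(P)=1-\frac{4\operatorname{Tr}P}{m(m+1)}+\frac{4(\operatorname{Tr}P)^2+8\operatorname{Tr}(P^2)}{m(m+1)(m+2)(m+3)}.$$ Let $\beta_{2q}(m)$ be given by the integral formula of Douglas, Shiffman and Zelditch, $$\beta_{2q}(m)=\frac{(-i)^{m(m-1)/2}}{4\pi^{2m}\prod_{j=1}^{m-1}j!}\int_{Y_{2m-q}}\Delta(\lambda)\prod_{j=1}^m|\lambda_j|\left[\int_{\mathbb R}\cdots\int_{\mathbb R}\Delta(\xi)\,e^{i\langle\lambda,\xi\rangle}\,\mathcal I(\lambda,\xi)\,d\xi_1\cdots d\xi_m\right]d\lambda,$$ $$\mathcal I(\lambda,\xi)=\frac{F(D(\lambda))+\left[\frac{4\sum_j\lambda_j}{m(m+1)(m+3)}-\frac{2}{m+1}\right]\frac{1}{1-\frac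 i2\sum_j\xi_j}+\frac{2}{(m+1)(m+3)\left(1-\frac i2\sum_j\xi_j\right)^2}}{\left(1-\frac i2\sum_j\xi_j\right)\prod_{j\le k}\left[1+\frac i2(\xi_j+\xi_k)\right]},$$ where the bracketed $\xi$-integrals are taken in the sense of distributions in $\lambda$ on $Y_{2m-q}$: their value is the locally integrable function $f$ on $Y_{2m-q}$ such that, for every $\varphi\in C_c^\infty(Y_{2m-q})$, $$\int f(\lambda)\varphi(\lambda)\,d\lambda=\int_{\mathbb R^m}\left(\int\Delta(\xi)\,e^{i\langle\lambda,\xi\rangle}\,\mathcal I(\lambda,\xi)\,\varphi(\lambda)\,d\lambda\right)d\xi ,$$ the outer $\xi$-integral being absolutely convergent. Define $$\mathcal I_m(\lambda)=\frac{2F(D(\lambda))}{m+2}+\frac{16(m+2)\sum_{j}\lambda_j+16m}{m(m+1)(m+2)^3(m+3)}-\frac{8}{(m+1)(m+2)^2}$$ and, for $m<q\le 2m$, $$\mathcal I_q(\lambda)=\left(\frac{2F(D(\lambda))}{m+2}+\frac{8\left((m+2)^2\lambda_m^2-2(m+2)\lambda_m+2\right)}{(m+1)(m+2)^3(m+3)}-\frac{4((m+2)\lambda_m-1)}{(m+2)^2}\left(\frac{4\sum_{j}\lambda_j}{m(m+1)(m+3)}-\frac{2}{m+1}\right)\right)e^{(m+2)\lambda_m}.$$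 Then on $Y_{2m-q}$ the $\xi$-integrals exist in the above sense and equal $$i^{m(m-1)/2}\,2^{(m^2+m)/2}\,\pi^m\,\mathcal I_q(\lambda)\,e^{-\sum_j\lambda_j},$$ and $$\beta_{2q}(m)=\frac{2^{\frac{m^2+m}{2}}}{4\pi^m\prod_{j=1}^{m-1}j!}\int_{Y_{2m-q}}\mathcal I_q(\lambda)\,\Delta(\lambda)\prod_{j=1}^m|\lambda_j|\,e^{-\sum_{j=1}^m\lambda_j}\,d\lambda,$$ where the last integral converges absolutely. -/

import Mathlib

open scoped ContDiff
open MeasureTheory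

namespace DSZ

/-- The chamber `Y_p = {x ∈ ℝ^m : x_1 > ⋯ > x_p > 0 > x_{p+1} > ⋯ > x_m}`
(the coordinate `x_{j+1}` of the mathematical notation is `x j`, for `j : Fin m`). -/
def chamber (m p : ℕ) : Set (Fin m → ℝ) :=
  {x | StrictAnti x ∧ (∀ j : Fin m, (j : ℕ) < p → 0 < x j) ∧ (∀ j : Fin m, p ≤ (j : ℕ) → x j < 0)}

/-- The Vandermonde product `Δ(x) = ∏_{i < j} (x_i - x_j)`. -/
noncomputable def vandermonde {m : ℕ} (x : Fin m → ℝ) : ℝ :=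
  ∏ i, ∏ j ∈ Finset.Ioi i, (x i - x j)

/-- `F(P) = 1 - 4 Tr P / (m(m+1)) + (4 (Tr P)² + 8 Tr(P²)) / (m(m+1)(m+2)(m+3))`. -/
noncomputable def F {m : ℕ} (P : Matrix (Fin m) (Fin m) ℝ) : ℝ :=
  1 - 4 * P.trace / ((m : ℝ) * (m + 1))
    + (4 * P.trace ^ 2 + 8 * (P ^ 2).trace) / ((m : ℝ) * (m + 1) * (m + 2) * (m + 3))

/-- The factor `1 - (i/2) ∑_j ξ_j`. -/
noncomputable def poleFactor {m : ℕ} (ξ : Fin m → ℝ) : ℂ :=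
  1 - Complex.I / 2 * ∑ j, (ξ j : ℂ)

/-- The rational function `𝓘(x, ξ)` in the integral formula for `β_{2q}(m)`. -/
noncomputable def kernelI {m : ℕ} (x ξ : Fin m → ℝ) : ℂ :=
  ((F (Matrix.diagonal x) : ℂ)
      + (4 * (∑ j, (x j : ℂ)) / ((m : ℂ) * (m + 1) * (m + 3)) - 2 / ((m : ℂ) + 1))
          * (1 / poleFactor ξ)
      + 2 / (((m : ℂ) + 1) * (m + 3) * poleFactor ξ ^ 2))
    / (poleFactor ξ * ∏ j, ∏ k ∈ Finset.Ici j, (1 + Complex.I / 2 * ((ξ j : ℂ) + (ξ k : ℂ))))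

/-- The integrand `Δ(ξ) e^{i⟨x, ξ⟩} 𝓘(x, ξ)` of the `ξ`-integrals. -/
noncomputable def xiIntegrand {m : ℕ} (x ξ : Fin m → ℝ) : ℂ :=
  (vandermonde ξ : ℂ) * Complex.exp (Complex.I * ∑ j, (x j : ℂ) * (ξ j : ℂ)) * kernelI x ξ

/-- On the set `U`, the function `f` is the value of
`∫_ℝ ⋯ ∫_ℝ Δ(ξ) e^{i⟨x, ξ⟩} 𝓘(x, ξ) dξ_1 ⋯ dξ_m` in the sense of distributions in `x`:
`f` is locally integrable on `U`, and for every smooth `φ` with compact support in `U` one has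
`∫ f(x) φ(x) dx = ∫_{ℝ^m} (∫ Δ(ξ) e^{i⟨x, ξ⟩} 𝓘(x, ξ) φ(x) dx) dξ`,
the outer integral on the right being absolutely convergent. -/
def IsXiIntegralOn {m : ℕ} (U : Set (Fin m → ℝ)) (f : (Fin m → ℝ) → ℂ) : Prop :=
  LocallyIntegrableOn f U ∧
    ∀ φ : (Fin m → ℝ) → ℂ, ContDiff ℝ ∞ φ → HasCompactSupport φ → tsupport φ ⊆ U →
      Integrable (fun ξ : Fin m → ℝ => ∫ x, xiIntegrand x ξ * φ x) ∧
        ∫ x, f x * φ x = ∫ ξ : Fin m → ℝ, ∫ x, xiIntegrand x ξ * φ x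

/-- The distributional `ξ`-integral on the open set `U`, as a function. Any two functions with the
property `IsXiIntegralOn U` agree almost everywhere on `U`. -/
noncomputable def xiIntegral {m : ℕ} (U : Set (Fin m → ℝ)) : (Fin m → ℝ) → ℂ :=
  Classical.epsilon (IsXiIntegralOn U)

/-- The integral formula of Douglas, Shiffman and Zelditch for `β_{2q}(m)`. -/
noncomputable def beta (m q : ℕ) : ℂ :=
  (-Complex.I) ^ (m * (m - 1) / 2)
      / (4 * (Real.pi : ℂ) ^ (2 * m) * ∏ j ∈ Finset.Icc 1 (m - 1), (Nat.factorial j : ℂ))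
    * ∫ x in chamber m (2 * m - q),
        (vandermonde x : ℂ) * ((∏ j, |x j| : ℝ) : ℂ) * xiIntegral (chamber m (2 * m - q)) x

/-- The polynomial `𝓘_m(x)`. -/
noncomputable def calImin {m : ℕ} (x : Fin m → ℝ) : ℝ :=
  2 * F (Matrix.diagonal x) / (m + 2)
    + (16 * ((m : ℝ) + 2) * (∑ j, x j) + 16 * m) / ((m : ℝ) * (m + 1) * (m + 2) ^ 3 * (m + 3))
    - 8 / (((m : ℝ) + 1) * (m + 2) ^ 2)

/-- The function `𝓘_q(x)` for `m < q ≤ 2m`, with `t` the last coordinate `x_m` of `x`. -/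
noncomputable def calIexp {m : ℕ} (x : Fin m → ℝ) (t : ℝ) : ℝ :=
  (2 * F (Matrix.diagonal x) / (m + 2)
      + 8 * (((m : ℝ) + 2) ^ 2 * t ^ 2 - 2 * ((m : ℝ) + 2) * t + 2)
          / (((m : ℝ) + 1) * (m + 2) ^ 3 * (m + 3))
      - 4 * (((m : ℝ) + 2) * t - 1) / ((m : ℝ) + 2) ^ 2
          * (4 * (∑ j, x j) / ((m : ℝ) * (m + 1) * (m + 3)) - 2 / ((m : ℝ) + 1)))
    * Real.exp (((m : ℝ) + 2) * t)

/-- The function `𝓘_q(x)` on `ℝ^m`, for `m ≥ 1` and `m ≤ q ≤ 2m`. -/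
noncomputable def calI {m : ℕ} (hm : 1 ≤ m) (q : ℕ) (x : Fin m → ℝ) : ℝ :=
  if q = m then calImin x else calIexp x (x ⟨m - 1, Nat.sub_one_lt_of_le hm le_rfl⟩)

end DSZ

namespace DSZ

/-! Schur's identity (`sum_sign_prod_inv_init`), applied to z_j = 1 + iξ_j, turns Δ(ξ) / ∏_{j ≤ k}
(1 + (i/2)(ξ_j + ξ_k)) into (2i)^{m(m-1)/2} times an alternating sum over permutations σ of ∏_k
1/Z_k, with Z_k = ∑_{j ≤ k} z_{σ j}. The Z_k and the pole factor w have positive real part, so 1/Z_k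
= ∫_0^∞ e^{-Z_k s} ds and w^{-(n+1)} = ∫_0^∞ t^n/n! e^{-wt} dt. Each summand is therefore the
Fourier transform of an integrable weight in (s, t) pushed forward along `paramPoint σ`
(`integral_weight_mul_exp`).

Fourier inversion against a test function replaces the ξ-integral by (2π)^m times the integral of
the test function along that push-forward (`integral_fourier_weight_mul`). Points reached from σ
satisfy x_{σ 0} > x_{σ 1} > ⋯, so test functions supported on decreasing vectors see only σ = 1. For
σ = 1 a unimodular change of variables trades s for x; the weight becomes e^{-∑ x_j} t^n/n!
e^{-(m+2)t/2}, and t runs over t > max(0, -2x_m) (`integral_weight_mul_comp_paramPoint_one`). The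
sign of the last coordinate is what separates q = m from q > m. Summing n = 0, 1, 2 with the
coefficients of the kernel gives 𝓘_q (`calI_eq`).

The integral over the chamber converges because the exponent is bounded above by -(1/m) ∑ |x_j|
there. The formula for β follows since the distributional value is unique almost everywhere
(`IsXiIntegralOn.ae_eq`). -/

/-! ### Schur's identity for alternating sums over permutations. -/

/-- Lagrange interpolation of ∏ (X + z_j) - ∏ (X - z_j) at the nodes z_l: its coefficient of X^n is
2 ∑ z_l, and its value at z_l is 2 z_l ∏_{j ≠ l} (z_l + z_j). -/
theorem sum_mul_prod_add_div_sub {n : ℕ} (z : Fin (n + 1) → ℂ) (hz : Function.Injective z) :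
    ∑ l, z l * ∏ j ∈ Finset.univ.erase l, (z l + z j) / (z l - z j) = ∑ l, z l := by
  classical
  set A : Polynomial ℂ := ∏ j, (Polynomial.X - Polynomial.C (-z j)) with hA
  set B : Polynomial ℂ := ∏ j, (Polynomial.X - Polynomial.C (z j)) with hB
  have hcard : (Finset.univ : Finset (Fin (n + 1))).card = n + 1 := by simp
  have hAm : A.Monic := Polynomial.monic_prod_of_monic _ _ fun i _ => Polynomial.monic_X_sub_C _
  have hBm : B.Monic := Polynomial.monic_prod_of_monic _ _ fun i _ => Polynomial.monic_X_sub_C _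
  have hAd : A.degree = (n + 1 : ℕ) := by
    rw [hA, Polynomial.degree_prod]; simp
  have hBd : B.degree = (n + 1 : ℕ) := by
    rw [hB, Polynomial.degree_prod]; simp
  have hdeg : (A - B).degree < (Finset.univ : Finset (Fin (n + 1))).card := by
    rw [hcard, ← hAd]
    refine Polynomial.degree_sub_lt_left (by rw [hAd, hBd]) hAm.ne_zero ?_
    rw [hAm.leadingCoeff, hBm.leadingCoeff]
  have hco := Lagrange.coeff_eq_sum (s := Finset.univ) (v := z) hz.injOn hdeg
  have hAc := Polynomial.prod_X_sub_C_coeff_card_pred Finset.univ (fun j => -z j) (by simp)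
  have hBc := Polynomial.prod_X_sub_C_coeff_card_pred Finset.univ z (by simp)
  rw [Polynomial.coeff_sub, hAc, hBc] at hco
  have key : ∀ l, (A - B).eval (z l) / ∏ j ∈ Finset.univ.erase l, (z l - z j)
      = 2 * (z l * ∏ j ∈ Finset.univ.erase l, (z l + z j) / (z l - z j)) := by
    intro l
    have hB0 : B.eval (z l) = 0 := by
      rw [hB, Polynomial.eval_prod]
      exact Finset.prod_eq_zero (Finset.mem_univ l) (by simp)
    have hA0 : A.eval (z l) = 2 * z l * ∏ j ∈ Finset.univ.erase l, (z l + z j) := by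
      rw [hA, Polynomial.eval_prod, ← Finset.mul_prod_erase _ _ (Finset.mem_univ l)]
      simp only [Polynomial.eval_sub, Polynomial.eval_X, Polynomial.eval_C, sub_neg_eq_add]
      ring
    rw [Polynomial.eval_sub, hB0, hA0, Finset.prod_div_distrib]
    ring
  rw [Finset.sum_congr rfl fun l _ => key l, ← Finset.mul_sum, Finset.sum_neg_distrib] at hco
  linear_combination -hco / 2

/-- The Schur product `∏ 1 / z_j * ∏_{j < k} (z_j - z_k) / (z_j + z_k)`. -/
noncomputable def schurProd {n : ℕ} (z : Fin n → ℂ) : ℂ :=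
  (∏ j, (z j)⁻¹) * ∏ j, ∏ k ∈ Finset.Ioi j, (z j - z k) / (z j + z k)

theorem schurProd_comp_perm {n : ℕ} (z : Fin n → ℂ) (σ : Equiv.Perm (Fin n)) :
    schurProd (fun i => z (σ i)) = (Equiv.Perm.sign σ : ℤ) * schurProd z := by
  have h := σ.prod_Ioi_comp_eq_sign_mul_prod (f := fun j k => (z j - z k) / (z j + z k))
    (fun i j => by rw [← neg_div, neg_sub, add_comm (z i)])
  simp only [schurProd]
  rw [h, Equiv.prod_comp σ (fun j => (z j)⁻¹)]
  ring

theorem schurProd_succ {n : ℕ} (z : Fin (n + 1) → ℂ) :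
    schurProd z = (z 0)⁻¹ * (∏ j : Fin n, (z 0 - z j.succ) / (z 0 + z j.succ))
      * schurProd (fun j => z j.succ) := by
  simp only [schurProd, Fin.prod_univ_succ, Fin.prod_Ioi_zero, Fin.prod_Ioi_succ]
  ring

theorem prod_erase_swap {n : ℕ} (f : Fin (n + 1) → ℂ) (p : Fin (n + 1)) :
    ∏ j ∈ Finset.univ.erase p, f j = ∏ j : Fin n, f (Equiv.swap 0 p j.succ) := by
  classical
  have h : ∏ j ∈ Finset.univ.erase p, f j
      = ∏ j ∈ Finset.univ.erase 0, f (Equiv.swap 0 p j) := by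
    refine (Finset.prod_bij' (fun j _ => Equiv.swap 0 p j) (fun j _ => Equiv.swap 0 p j)
      ?_ ?_ ?_ ?_ ?_).symm
    · intro a ha
      simp only [Finset.mem_erase, Finset.mem_univ, and_true] at ha ⊢
      intro h
      exact ha (by simpa using congrArg (Equiv.swap 0 p) h)
    · intro a ha
      simp only [Finset.mem_erase, Finset.mem_univ, and_true] at ha ⊢
      intro h
      exact ha (by simpa using congrArg (Equiv.swap 0 p) h)
    · simp
    · simp
    · simp
  rw [h, show Finset.univ.erase (0 : Fin (n + 1)) = Finset.univ.map (Fin.succEmb n) from ?_,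
    Finset.prod_map]
  · rfl
  · ext j
    simp [Fin.exists_succ_eq]

/-- Induction on n, grouping permutations by p = σ 0. The full sum ∑ z_j factors out, and the rest
is the identity for the variables other than z_p, equal up to sign to `schurProd z` times z_p ∏_{j ≠
p} (z_p + z_j)/(z_p - z_j). The interpolation identity then sums over p and cancels the factored ∑
z_j. -/
theorem sum_sign_prod_inv_tail_of_injective {n : ℕ} (z : Fin n → ℂ) (hz : Function.Injective z)
    (hre : ∀ j, 0 < (z j).re) :
    ∑ σ : Equiv.Perm (Fin n), ((Equiv.Perm.sign σ : ℤ) : ℂ) *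
      ∏ k, (∑ j ∈ Finset.Ici k, z (σ j))⁻¹ = schurProd z := by
  induction n with
  | zero => simp [schurProd]
  | succ n ih =>
    have hadd : ∀ i j, z i + z j ≠ 0 := fun i j h => by
      have := congrArg Complex.re h
      have h1 := hre i
      have h2 := hre j
      simp only [Complex.add_re, Complex.zero_re] at this
      linarith
    have hS : (∑ j, z j) ≠ 0 := fun h => by
      have := congrArg Complex.re h
      rw [Complex.re_sum, Complex.zero_re] at this
      exact (Finset.sum_pos (fun j _ => hre j) Finset.univ_nonempty).ne' this
    rw [← Equiv.sum_comp Equiv.Perm.decomposeFin.symm, Fintype.sum_prod_type]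
    have inner : ∀ p : Fin (n + 1), ∑ e : Equiv.Perm (Fin n),
        ((Equiv.Perm.sign (Equiv.Perm.decomposeFin.symm (p, e)) : ℤ) : ℂ) *
          ∏ k, (∑ j ∈ Finset.Ici k, z (Equiv.Perm.decomposeFin.symm (p, e) j))⁻¹
        = (∑ j, z j)⁻¹ * (schurProd z *
          (z p * ∏ j ∈ Finset.univ.erase p, (z p + z j) / (z p - z j))) := by
      intro p
      have hsgn : (((Equiv.Perm.sign (Equiv.swap 0 p) : ℤˣ) : ℤ) : ℂ)
          * (((Equiv.Perm.sign (Equiv.swap 0 p) : ℤˣ) : ℤ) : ℂ) = 1 := by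
        rcases Int.units_eq_one_or (Equiv.Perm.sign (Equiv.swap 0 p)) with h | h <;> simp [h]
      have hw := ih (fun j : Fin n => z (Equiv.swap 0 p j.succ))
        (fun a b hab => by simpa using hz hab) (fun j => hre _)
      have hperm := schurProd_comp_perm z (Equiv.swap 0 p)
      rw [schurProd_succ, Equiv.swap_apply_left] at hperm
      have hne : ∀ j ∈ Finset.univ.erase p, z p - z j ≠ 0 := fun j hj h =>
        Finset.ne_of_mem_erase hj (hz (sub_eq_zero.mp h)).symm
      have hz0 : z p ≠ 0 := fun h => by have := hre p; simp [h] at this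
      rw [← prod_erase_swap (fun j => (z p - z j) / (z p + z j)) p] at hperm
      have hinv : (∏ j ∈ Finset.univ.erase p, (z p + z j) / (z p - z j))
          * ∏ j ∈ Finset.univ.erase p, (z p - z j) / (z p + z j) = 1 := by
        rw [← Finset.prod_mul_distrib]
        refine Finset.prod_eq_one fun j hj => ?_
        have := hne j hj
        have := hadd p j
        field_simp
      have htail : schurProd (fun j : Fin n => z (Equiv.swap 0 p j.succ))
          = (((Equiv.Perm.sign (Equiv.swap 0 p) : ℤˣ) : ℤ) : ℂ) * (schurProd z *
          (z p * ∏ j ∈ Finset.univ.erase p, (z p + z j) / (z p - z j))) := by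
        calc _ = (z p * (z p)⁻¹) * ((∏ j ∈ Finset.univ.erase p, (z p + z j) / (z p - z j))
          * ∏ j ∈ Finset.univ.erase p, (z p - z j) / (z p + z j)) *
            schurProd (fun j : Fin n => z (Equiv.swap 0 p j.succ)) := by
              rw [hinv, mul_inv_cancel₀ hz0]; ring
          _ = _ := by linear_combination (z p *
            ∏ j ∈ Finset.univ.erase p, (z p + z j) / (z p - z j)) * hperm
      have hterm : ∀ e : Equiv.Perm (Fin n),
        ((Equiv.Perm.sign (Equiv.Perm.decomposeFin.symm (p, e)) : ℤ) : ℂ) *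
          ∏ k, (∑ j ∈ Finset.Ici k, z (Equiv.Perm.decomposeFin.symm (p, e) j))⁻¹
        = ((((Equiv.Perm.sign (Equiv.swap 0 p) : ℤˣ) : ℤ) : ℂ) * (∑ j, z j)⁻¹) *
          (((Equiv.Perm.sign e : ℤ) : ℂ) *
            ∏ k, (∑ j ∈ Finset.Ici k, z (Equiv.swap 0 p (e j).succ))⁻¹) := by
        intro e
        have hs : Equiv.Perm.sign (Equiv.Perm.decomposeFin.symm (p, e))
            = Equiv.Perm.sign (Equiv.swap 0 p) * Equiv.Perm.sign e := by
          rw [Equiv.Perm.decomposeFin.symm_sign]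
          by_cases h : p = 0
          · simp [h]
          · simp [h, Equiv.Perm.sign_swap (Ne.symm h)]
        have h0 : ∑ j ∈ Finset.Ici 0, z (Equiv.Perm.decomposeFin.symm (p, e) j) = ∑ j, z j := by
          rw [show Finset.Ici (0 : Fin (n + 1)) = Finset.univ by ext; simp]
          exact Equiv.sum_comp _ z
        have hk : ∀ k : Fin n,
            ∑ j ∈ Finset.Ici k.succ, z (Equiv.Perm.decomposeFin.symm (p, e) j)
              = ∑ j ∈ Finset.Ici k, z (Equiv.swap 0 p (e j).succ) := by
          intro k
          rw [← Fin.map_succEmb_Ici, Finset.sum_map]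
          refine Finset.sum_congr rfl fun j _ => ?_
          rw [Fin.coe_succEmb, Equiv.Perm.decomposeFin_symm_apply_succ]
        rw [hs, Fin.prod_univ_succ, h0, Finset.prod_congr rfl fun k _ => by rw [hk k]]
        push_cast
        ring
      rw [Finset.sum_congr rfl fun e _ => hterm e, ← Finset.mul_sum, hw, htail]
      linear_combination ((∑ j, z j)⁻¹ * (schurProd z *
          (z p * ∏ j ∈ Finset.univ.erase p, (z p + z j) / (z p - z j)))) * hsgn
    rw [Finset.sum_congr rfl fun p _ => inner p, ← Finset.mul_sum, ← Finset.mul_sum,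
      sum_mul_prod_add_div_sub z hz]
    field_simp

theorem sum_sign_comp_perm {n : ℕ} (g : (Fin n → ℂ) → ℂ) (z : Fin n → ℂ)
    (τ : Equiv.Perm (Fin n)) :
    ∑ σ : Equiv.Perm (Fin n), ((Equiv.Perm.sign σ : ℤ) : ℂ) * g (fun j => z (τ (σ j)))
      = ((Equiv.Perm.sign τ : ℤ) : ℂ) *
        ∑ σ : Equiv.Perm (Fin n), ((Equiv.Perm.sign σ : ℤ) : ℂ) * g (fun j => z (σ j)) := by
  rw [← Equiv.sum_comp (Equiv.mulLeft τ)
    (fun σ : Equiv.Perm (Fin n) => ((Equiv.Perm.sign σ : ℤ) : ℂ) * g (fun j => z (σ j))),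
    Finset.mul_sum]
  refine Finset.sum_congr rfl fun σ _ => ?_
  have hsgn : (((Equiv.Perm.sign τ : ℤˣ) : ℤ) : ℂ) * (((Equiv.Perm.sign τ : ℤˣ) : ℤ) : ℂ) = 1 := by
    rcases Int.units_eq_one_or (Equiv.Perm.sign τ) with h | h <;> simp [h]
  simp only [Equiv.coe_mulLeft, Equiv.Perm.sign_mul, Units.val_mul, Int.cast_mul,
    Equiv.Perm.mul_apply]
  linear_combination (-((Equiv.Perm.sign σ : ℤ) : ℂ) * g (fun j => z (τ (σ j)))) * hsgn

/-- **Schur's identity**, in the form with tail sums. -/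
theorem sum_sign_prod_inv_tail {n : ℕ} (z : Fin n → ℂ) (hre : ∀ j, 0 < (z j).re) :
    ∑ σ : Equiv.Perm (Fin n), ((Equiv.Perm.sign σ : ℤ) : ℂ) *
      ∏ k, (∑ j ∈ Finset.Ici k, z (σ j))⁻¹ = schurProd z := by
  by_cases hz : Function.Injective z
  · exact sum_sign_prod_inv_tail_of_injective z hz hre
  -- Both sides are antisymmetric and invariant under swapping two equal arguments, so both vanish.
  · obtain ⟨a, b, hab, hne⟩ := Function.not_injective_iff.mp hz
    have hcomp : ∀ i, z (Equiv.swap a b i) = z i := fun i => by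
      rcases eq_or_ne i a with rfl | ha
      · simp [hab]
      · rcases eq_or_ne i b with rfl | hb
        · simp [hab]
        · rw [Equiv.swap_apply_of_ne_of_ne ha hb]
    have h1 := sum_sign_comp_perm (fun w => ∏ k, (∑ j ∈ Finset.Ici k, w j)⁻¹) z (Equiv.swap a b)
    have h2 := schurProd_comp_perm z (Equiv.swap a b)
    simp only [hcomp, Equiv.Perm.sign_swap hne, Units.val_neg, Units.val_one, Int.cast_neg,
      Int.cast_one] at h1 h2
    linear_combination h1 / 2 - h2 / 2

/-- **Schur's identity**, in the form with initial sums. -/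
theorem sum_sign_prod_inv_init {n : ℕ} (z : Fin n → ℂ) (hre : ∀ j, 0 < (z j).re) :
    ∑ σ : Equiv.Perm (Fin n), ((Equiv.Perm.sign σ : ℤ) : ℂ) *
      ∏ k, (∑ j ∈ Finset.Iic k, z (σ j))⁻¹
        = (∏ j, (z j)⁻¹) * ∏ j, ∏ k ∈ Finset.Ioi j, (z k - z j) / (z j + z k) := by
  have h := sum_sign_prod_inv_tail (fun j => z (Fin.rev j)) fun j => hre _
  have hrhs : schurProd (fun j => z (Fin.rev j))
      = (∏ j, (z j)⁻¹) * ∏ j, ∏ k ∈ Finset.Ioi j, (z k - z j) / (z j + z k) := by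
    simp only [schurProd]
    refine congrArg₂ _ (Equiv.prod_comp Fin.revPerm fun j => (z j)⁻¹) ?_
    rw [Finset.prod_sigma', Finset.prod_sigma']
    refine Finset.prod_bij' (fun p _ => ⟨Fin.rev p.2, Fin.rev p.1⟩)
      (fun p _ => ⟨Fin.rev p.2, Fin.rev p.1⟩) ?_ ?_ ?_ ?_ ?_
    · simp
    · simp
    · simp
    · simp
    · intro a _
      simp [add_comm]
  -- Conjugating σ by the order reversal preserves its sign and exchanges tail sums with initial
  -- sums.
  rw [← hrhs, ← h, ← Equiv.sum_comp (MulAut.conj (Fin.revPerm : Equiv.Perm (Fin n))).toEquiv]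
  refine Finset.sum_congr rfl fun σ _ => ?_
  have hsgn : Equiv.Perm.sign ((MulAut.conj (Fin.revPerm : Equiv.Perm (Fin n))) σ)
      = Equiv.Perm.sign σ := by
    rw [MulAut.conj_apply, Equiv.Perm.sign_mul, Equiv.Perm.sign_mul, Equiv.Perm.sign_inv, mul_right_comm,
      Int.units_mul_self, one_mul]
  simp only [MulEquiv.toEquiv_eq_coe, EquivLike.coe_coe, hsgn]
  congr 1
  rw [← Equiv.prod_comp Fin.revPerm]
  refine Finset.prod_congr rfl fun k _ => ?_
  congr 1
  refine Finset.sum_bij' (fun j _ => Fin.rev j) (fun j _ => Fin.rev j) ?_ ?_ ?_ ?_ ?_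
  · intro a ha
    simp only [Fin.revPerm_apply, Finset.mem_Iic, Finset.mem_Ici] at ha ⊢
    rw [← Fin.rev_le_rev, Fin.rev_rev]; exact ha
  · intro a ha
    simp only [Fin.revPerm_apply, Finset.mem_Iic, Finset.mem_Ici] at ha ⊢
    rw [← Fin.rev_le_rev, Fin.rev_rev]; simpa using ha
  · simp
  · simp
  · intro a _
    simp [MulAut.conj_apply, Equiv.Perm.mul_apply]

/-! ### The rational factor of the kernel. -/

theorem prod_prod_Ioi_const {n : ℕ} (c : ℂ) :
    ∏ j : Fin n, ∏ _k ∈ Finset.Ioi j, c = c ^ (n * (n - 1) / 2) := by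
  simp only [Finset.prod_const, Fin.card_Ioi]
  rw [Finset.prod_pow_eq_pow_sum]
  congr 1
  rw [← Finset.sum_range_id, ← Finset.sum_range_reflect, Finset.sum_range]

/-- The rational factor of the integrand, as an alternating sum. -/
theorem vandermonde_div_prod_eq {m : ℕ} (ξ : Fin m → ℝ) :
    (vandermonde ξ : ℂ) / ∏ j, ∏ k ∈ Finset.Ici j, (1 + Complex.I / 2 * ((ξ j : ℂ) + (ξ k : ℂ)))
      = (2 * Complex.I) ^ (m * (m - 1) / 2) *
        ∑ σ : Equiv.Perm (Fin m), ((Equiv.Perm.sign σ : ℤ) : ℂ) *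
          ∏ k, (∑ j ∈ Finset.Iic k, (1 + Complex.I * (ξ (σ j) : ℂ)))⁻¹ := by
  rw [sum_sign_prod_inv_init (fun j => 1 + Complex.I * (ξ j : ℂ)) (fun j => by simp)]
  have hadd : ∀ j k, (1 + Complex.I / 2 * ((ξ j : ℂ) + (ξ k : ℂ))) ≠ 0 := fun j k h => by
    have := congrArg Complex.re h
    simp at this
  -- The diagonal factors k = j are the z_j = 1 + iξ_j; each pair j < k then contributes one
  -- constant 2i.
  have hden : ∏ j, ∏ k ∈ Finset.Ici j, (1 + Complex.I / 2 * ((ξ j : ℂ) + (ξ k : ℂ)))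
      = (∏ j, (1 + Complex.I * (ξ j : ℂ))) *
        ∏ j, ∏ k ∈ Finset.Ioi j, (1 + Complex.I / 2 * ((ξ j : ℂ) + (ξ k : ℂ))) := by
    rw [← Finset.prod_mul_distrib]
    refine Finset.prod_congr rfl fun j _ => ?_
    rw [← Finset.Ioi_insert, Finset.prod_insert (by simp)]
    congr 1
    ring
  rw [hden, vandermonde, ← prod_prod_Ioi_const]
  push_cast
  rw [Finset.prod_inv_distrib, div_eq_mul_inv, mul_inv, mul_left_comm, mul_left_comm _ (_⁻¹)]
  congr 1
  simp only [← Finset.prod_inv_distrib, ← Finset.prod_mul_distrib]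
  refine Finset.prod_congr rfl fun j _ => Finset.prod_congr rfl fun k _ => ?_
  have h1 := hadd j k
  rw [show (1 + Complex.I * (ξ j : ℂ)) + (1 + Complex.I * (ξ k : ℂ))
    = 2 * (1 + Complex.I / 2 * ((ξ j : ℂ) + (ξ k : ℂ))) by ring]
  generalize 1 + Complex.I / 2 * ((ξ j : ℂ) + (ξ k : ℂ)) = w at h1
  rw [mul_inv_eq_iff_eq_mul₀ h1]
  calc (ξ j : ℂ) - ξ k = Complex.I ^ 2 * (ξ k - ξ j) := by rw [Complex.I_sq]; ring
    _ = _ := by field_simp; ring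

/-! ### Fourier inversion and pairing with test functions. -/

open scoped FourierTransform in
theorem integral_exp_mul_eq_fourierInv {m : ℕ} {ψ : (Fin m → ℝ) → ℂ}
    (f : SchwartzMap (EuclideanSpace ℝ (Fin m)) ℂ) (hf : ∀ x, f (WithLp.toLp 2 x) = ψ x)
    (ξ : Fin m → ℝ) :
    ∫ x, Complex.exp (Complex.I * ∑ j, (x j : ℂ) * (ξ j : ℂ)) * ψ x
      = (𝓕⁻ f) (WithLp.toLp 2 ((2 * Real.pi)⁻¹ • ξ)) := by
  rw [SchwartzMap.fourierInv_coe, Real.fourierInv_eq',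
    ← (PiLp.volume_preserving_toLp (Fin m)).integral_comp
      (MeasurableEquiv.toLp 2 (Fin m → ℝ)).measurableEmbedding]
  refine integral_congr_ae (Filter.Eventually.of_forall fun x => ?_)
  simp only [hf, smul_eq_mul]
  congr 2
  rw [PiLp.inner_apply]
  have h : (2 * (Real.pi : ℂ)) ≠ 0 := by
    exact_mod_cast (by positivity : (2 * Real.pi) ≠ 0)
  simp only [RCLike.inner_apply, conj_trivial, Pi.smul_apply, smul_eq_mul]
  push_cast
  rw [Finset.mul_sum, Finset.mul_sum, Finset.sum_mul]
  refine Finset.sum_congr rfl fun j _ => ?_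
  field_simp

/-- Fourier inversion for test functions, in the normalization `e^{i⟨x, ξ⟩}`. -/
theorem fourier_inversion {m : ℕ} {ψ : (Fin m → ℝ) → ℂ} (h1 : ContDiff ℝ ∞ ψ)
    (h2 : HasCompactSupport ψ) :
    Integrable (fun ξ : Fin m → ℝ =>
      ∫ x, Complex.exp (Complex.I * ∑ j, (x j : ℂ) * (ξ j : ℂ)) * ψ x) ∧
    ∀ y : Fin m → ℝ, ∫ ξ : Fin m → ℝ, Complex.exp (-(Complex.I * ∑ j, (y j : ℂ) * (ξ j : ℂ))) *
      ∫ x, Complex.exp (Complex.I * ∑ j, (x j : ℂ) * (ξ j : ℂ)) * ψ x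
        = (2 * Real.pi : ℂ) ^ m * ψ y := by
  open scoped FourierTransform in
  let e := EuclideanSpace.equiv (Fin m) ℝ
  have hs : ContDiff ℝ ∞ (ψ ∘ e) := h1.comp e.contDiff
  have hc : HasCompactSupport (ψ ∘ e) := h2.comp_homeomorph e.toHomeomorph
  let f : SchwartzMap (EuclideanSpace ℝ (Fin m)) ℂ := hc.toSchwartzMap hs
  have hf : ∀ x, f (WithLp.toLp 2 x) = ψ x := fun x => rfl
  have hmp := PiLp.volume_preserving_toLp (Fin m)
  have hme := (MeasurableEquiv.toLp 2 (Fin m → ℝ)).measurableEmbedding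
  have hpi : (2 * Real.pi)⁻¹ ≠ 0 := by positivity
  simp only [integral_exp_mul_eq_fourierInv f hf]
  constructor
  · have h : Integrable (fun ξ : Fin m → ℝ => (𝓕⁻ f) (WithLp.toLp 2 ξ)) :=
      (hmp.integrable_comp_emb hme).2 (𝓕⁻ f).integrable
    exact (integrable_comp_smul_iff volume _ hpi).2 h
  · intro y
    have hinv : 𝓕 (𝓕⁻ f) = f := FourierTransform.fourier_fourierInv_eq f
    have h3 := congrArg (fun g : SchwartzMap (EuclideanSpace ℝ (Fin m)) ℂ => g (WithLp.toLp 2 y)) hinv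
    simp only [hf, SchwartzMap.fourier_coe, Real.fourier_eq'] at h3
    rw [← hmp.integral_comp hme] at h3
    rw [← h3]
    -- Rescaling ξ by 1/(2π) to match the kernel e^{2πi⟨·,·⟩} produces the factor (2π)^m.
    have h4 := Measure.integral_comp_smul (volume : Measure (Fin m → ℝ)) (fun v =>
      Complex.exp (↑(-2 * Real.pi * inner ℝ (WithLp.toLp 2 v) (WithLp.toLp 2 y)) * Complex.I) •
        (𝓕⁻ f) (WithLp.toLp 2 v)) (2 * Real.pi)⁻¹
    simp only [Module.finrank_fintype_fun_eq_card, Fintype.card_fin] at h4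
    have h5 : |(((2 * Real.pi)⁻¹ ^ m)⁻¹)| = (2 * Real.pi) ^ m := by
      rw [inv_pow, inv_inv, abs_of_pos (by positivity)]
    rw [h5] at h4
    rw [Complex.real_smul] at h4
    push_cast at h4 ⊢
    rw [← h4]
    refine integral_congr_ae (Filter.Eventually.of_forall fun ξ => ?_)
    simp only [smul_eq_mul]
    congr 2
    rw [PiLp.inner_apply]
    have h : (Real.pi : ℂ) ≠ 0 := by exact_mod_cast Real.pi_ne_zero
    simp only [RCLike.inner_apply, conj_trivial, Pi.smul_apply, smul_eq_mul]
    push_cast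
    rw [Finset.mul_sum, Finset.mul_sum, Finset.sum_mul, ← Finset.sum_neg_distrib]
    refine Finset.sum_congr rfl fun j _ => ?_
    field_simp

theorem norm_exp_neg_I_mul_sum {m : ℕ} (y ξ : Fin m → ℝ) :
    ‖Complex.exp (-(Complex.I * ∑ j, (y j : ℂ) * (ξ j : ℂ)))‖ = 1 := by
  rw [Complex.norm_exp]
  have : (-(Complex.I * ∑ j, (y j : ℂ) * (ξ j : ℂ))).re = 0 := by
    have : ∑ j, (y j : ℂ) * (ξ j : ℂ) = ((∑ j, y j * ξ j : ℝ) : ℂ) := by push_cast; rfl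
    rw [this]
    simp
  rw [this, Real.exp_zero]

/-- Pairing the Fourier transform of a weighted push-forward with that of a test function. -/
theorem integral_fourier_weight_mul {m : ℕ} {Ω : Type*} [MeasurableSpace Ω] {μ : Measure Ω}
    [SFinite μ] {w : Ω → ℂ} (hw : Integrable w μ) {L : Ω → Fin m → ℝ} (hL : Measurable L)
    {ψ : (Fin m → ℝ) → ℂ} (h1 : ContDiff ℝ ∞ ψ) (h2 : HasCompactSupport ψ) :
    Integrable (fun ξ : Fin m → ℝ =>
      (∫ a, w a * Complex.exp (-(Complex.I * ∑ j, (L a j : ℂ) * (ξ j : ℂ))) ∂μ) *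
        ∫ x, Complex.exp (Complex.I * ∑ j, (x j : ℂ) * (ξ j : ℂ)) * ψ x) ∧
    ∫ ξ : Fin m → ℝ, (∫ a, w a * Complex.exp (-(Complex.I * ∑ j, (L a j : ℂ) * (ξ j : ℂ))) ∂μ) *
        ∫ x, Complex.exp (Complex.I * ∑ j, (x j : ℂ) * (ξ j : ℂ)) * ψ x
      = (2 * Real.pi : ℂ) ^ m * ∫ a, w a * ψ (L a) ∂μ := by
  obtain ⟨hI, hinv⟩ := fourier_inversion h1 h2
  set Ψ : (Fin m → ℝ) → ℂ := fun ξ =>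
    ∫ x, Complex.exp (Complex.I * ∑ j, (x j : ℂ) * (ξ j : ℂ)) * ψ x with hΨ
  have hprod : Integrable (fun p : (Fin m → ℝ) × Ω => Ψ p.1 * w p.2) (volume.prod μ) :=
    hI.mul_prod hw
  have hmeas : Measurable fun p : (Fin m → ℝ) × Ω =>
      Complex.exp (-(Complex.I * ∑ j, (L p.2 j : ℂ) * (p.1 j : ℂ))) := by
    have : ∀ j, Measurable fun p : (Fin m → ℝ) × Ω => L p.2 j := fun j =>
      (measurable_pi_apply j).comp (hL.comp measurable_snd)
    fun_prop
  -- Fubini is available because the transform of the test function is integrable in ξ, the weight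
  -- is integrable in a, and the exponential has modulus 1; the transform of the weight itself need
  -- not be integrable.
  have hfull : Integrable (fun p : (Fin m → ℝ) × Ω =>
      Complex.exp (-(Complex.I * ∑ j, (L p.2 j : ℂ) * (p.1 j : ℂ))) * (Ψ p.1 * w p.2))
      (volume.prod μ) := by
    refine hprod.bdd_mul (c := 1) hmeas.aestronglyMeasurable ?_
    exact Filter.Eventually.of_forall fun p => (norm_exp_neg_I_mul_sum _ _).le
  have hin : ∀ ξ, ∫ a, Complex.exp (-(Complex.I * ∑ j, (L a j : ℂ) * (ξ j : ℂ))) * (Ψ ξ * w a) ∂μ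
      = (∫ a, w a * Complex.exp (-(Complex.I * ∑ j, (L a j : ℂ) * (ξ j : ℂ))) ∂μ) * Ψ ξ := by
    intro ξ
    rw [← integral_mul_const]
    exact integral_congr_ae (Filter.Eventually.of_forall fun a => by ring)
  constructor
  · refine hfull.integral_prod_left.congr (Filter.Eventually.of_forall fun ξ => ?_)
    exact hin ξ
  · rw [← integral_congr_ae (Filter.Eventually.of_forall hin), integral_integral_swap hfull,
      ← integral_const_mul]
    refine integral_congr_ae (Filter.Eventually.of_forall fun a => ?_)
    calc _ = ∫ ξ, w a *
          (Complex.exp (-(Complex.I * ∑ j, (L a j : ℂ) * (ξ j : ℂ))) * Ψ ξ) :=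
          integral_congr_ae (Filter.Eventually.of_forall fun ξ => by ring)
      _ = _ := by
        rw [integral_const_mul, hinv]
        ring

/-! ### Exponential integrals over half-lines. -/

theorem norm_pow_mul_exp_neg (P : ℂ) (k : ℕ) (t : ℝ) :
    ‖(t : ℂ) ^ k * Complex.exp (-(P * t))‖ = ‖t ^ k * Real.exp (-(P.re * t))‖ := by
  rw [norm_mul, norm_mul, norm_pow, norm_pow, Complex.norm_real, Complex.norm_exp,
    Real.norm_of_nonneg (Real.exp_pos _).le]
  simp

theorem integrableOn_pow_mul_exp_neg {P : ℂ} (hP : 0 < P.re) (k : ℕ) (T : ℝ) :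
    IntegrableOn (fun t : ℝ => (t : ℂ) ^ k * Complex.exp (-(P * t))) (Set.Ioi T) := by
  have hreal : IntegrableOn (fun t : ℝ => t ^ k * Real.exp (-(P.re * t))) (Set.Ioi T) := by
    refine integrable_of_isBigO_exp_neg (b := P.re / 2) (by linarith) (by fun_prop) ?_
    have h := (isLittleO_pow_exp_pos_mul_atTop (k := k) (b := P.re / 2) (by linarith)).isBigO.mul
      (Asymptotics.isBigO_refl (fun t : ℝ => Real.exp (-(P.re * t))) Filter.atTop)
    refine h.congr_right fun t => ?_
    rw [← Real.exp_add]
    congr 1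
    ring
  refine (integrable_norm_iff (Continuous.aestronglyMeasurable (by fun_prop))).1 ?_
  exact (hreal.norm).congr (Filter.Eventually.of_forall fun t => (norm_pow_mul_exp_neg P k t).symm)

theorem tendsto_pow_mul_exp_neg {P : ℂ} (hP : 0 < P.re) (k : ℕ) :
    Filter.Tendsto (fun t : ℝ => (t : ℂ) ^ k * Complex.exp (-(P * t))) Filter.atTop (nhds 0) := by
  rw [tendsto_zero_iff_norm_tendsto_zero]
  simp only [norm_pow_mul_exp_neg]
  rw [← tendsto_zero_iff_norm_tendsto_zero]
  have h := (isLittleO_pow_exp_pos_mul_atTop (k := k) hP).tendsto_div_nhds_zero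
  refine h.congr fun t => ?_
  rw [Real.exp_neg, div_eq_mul_inv]

/-- The integrand is the derivative of -(a + bt + ct²) e^{-Pt}, which tends to 0 at infinity. -/
theorem integral_Ioi_exp_neg_mul_quadratic {P : ℂ} (hP : 0 < P.re) (a b c : ℂ) (T : ℝ) :
    ∫ t : ℝ in Set.Ioi T, (P * (a + b * t + c * t ^ 2) - b - 2 * c * t) * Complex.exp (-(P * t))
      = (a + b * T + c * T ^ 2) * Complex.exp (-(P * T)) := by
  have hd : ∀ t ∈ Set.Ici T, HasDerivAt
      (fun t : ℝ => -((a + b * t + c * (t : ℂ) ^ 2) * Complex.exp (-(P * t))))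
      ((P * (a + b * t + c * (t : ℂ) ^ 2) - b - 2 * c * t) * Complex.exp (-(P * t))) t := by
    intro t _
    have h0 : HasDerivAt (fun t : ℝ => (t : ℂ)) 1 t := Complex.ofRealCLM.hasDerivAt
    have h1 := (((h0.const_mul b).const_add a).add ((h0.pow 2).const_mul c)).mul
      ((h0.const_mul P).neg.cexp)
    refine h1.neg.congr_deriv ?_
    simp only [Pi.add_apply, Pi.pow_apply, Pi.neg_apply]
    push_cast
    ring
  have e : ∀ a b c : ℂ, ∀ t : ℝ, (a + b * t + c * (t : ℂ) ^ 2) * Complex.exp (-(P * t))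
      = a * ((t : ℂ) ^ 0 * Complex.exp (-(P * t))) + b * ((t : ℂ) ^ 1 * Complex.exp (-(P * t)))
        + c * ((t : ℂ) ^ 2 * Complex.exp (-(P * t))) := fun a b c t => by ring
  have hint : IntegrableOn (fun t : ℝ =>
      (P * (a + b * t + c * (t : ℂ) ^ 2) - b - 2 * c * t) * Complex.exp (-(P * t)))
      (Set.Ioi T) := by
    have := (((integrableOn_pow_mul_exp_neg hP 0 T).const_mul (P * a - b)).add
      ((integrableOn_pow_mul_exp_neg hP 1 T).const_mul (P * b - 2 * c))).add
      ((integrableOn_pow_mul_exp_neg hP 2 T).const_mul (P * c))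
    refine this.congr (Filter.Eventually.of_forall fun t => ?_)
    simp only [Pi.add_apply]
    ring
  have ht : Filter.Tendsto
      (fun t : ℝ => -((a + b * t + c * (t : ℂ) ^ 2) * Complex.exp (-(P * t))))
      Filter.atTop (nhds 0) := by
    have := (((tendsto_pow_mul_exp_neg hP 0).const_mul a).add
      ((tendsto_pow_mul_exp_neg hP 1).const_mul b)).add
      ((tendsto_pow_mul_exp_neg hP 2).const_mul c) |>.neg
    simp only [← e] at this
    simpa using this
  rw [integral_Ioi_of_hasDerivAt_of_tendsto' hd hint ht]
  ring

/-- The normalized tail `∫_T^∞ t^n / n! e^{-Pt} dt`, multiplied by `e^{PT}`, for `n ≤ 2`. -/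
noncomputable def tailPoly (n : ℕ) (P T : ℂ) : ℂ :=
  ∑ k ∈ Finset.range (n + 1), T ^ k / (k.factorial : ℂ) / P ^ (n + 1 - k)

/-- As a polynomial in t, `tailPoly n P t` solves P u - u' = t^n/n!. Degrees up to 2 suffice, since
the kernel contains the pole factor to powers 1, 2 and 3. -/
theorem integral_Ioi_pow_mul_exp_neg {P : ℂ} (hP : 0 < P.re) {n : ℕ} (hn : n < 3) (T : ℝ) :
    ∫ t : ℝ in Set.Ioi T, (t : ℂ) ^ n / (n.factorial : ℂ) * Complex.exp (-(P * t))
      = tailPoly n P T * Complex.exp (-(P * T)) := by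
  have hP0 : P ≠ 0 := fun h => by simp [h] at hP
  interval_cases n
  · have h := integral_Ioi_exp_neg_mul_quadratic hP (1 / P) 0 0 T
    have h' : tailPoly 0 P T = 1 / P + 0 * T + 0 * (T : ℂ) ^ 2 := by
      simp [tailPoly]
    rw [h', ← h]
    refine integral_congr_ae (Filter.Eventually.of_forall fun t => ?_)
    simp [mul_inv_cancel₀ hP0]
  · have h := integral_Ioi_exp_neg_mul_quadratic hP (1 / P ^ 2) (1 / P) 0 T
    have h' : tailPoly 1 P T = 1 / P ^ 2 + 1 / P * T + 0 * (T : ℂ) ^ 2 := by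
      simp [tailPoly, Finset.sum_range_succ]
      ring
    rw [h', ← h]
    refine integral_congr_ae (Filter.Eventually.of_forall fun t => ?_)
    simp only [Nat.factorial]
    field_simp
    push_cast
    ring
  · have h := integral_Ioi_exp_neg_mul_quadratic hP (1 / P ^ 3) (1 / P ^ 2) (1 / (2 * P)) T
    have h' : tailPoly 2 P T = 1 / P ^ 3 + 1 / P ^ 2 * T + 1 / (2 * P) * (T : ℂ) ^ 2 := by
      simp [tailPoly, Finset.sum_range_succ]
      ring
    rw [h', ← h]
    refine integral_congr_ae (Filter.Eventually.of_forall fun t => ?_)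
    simp only [Nat.factorial]
    field_simp
    push_cast
    ring

theorem tailPoly_zero_right (n : ℕ) (P : ℂ) : tailPoly n P 0 = (P⁻¹) ^ (n + 1) := by
  rw [tailPoly, Finset.sum_range_succ']
  simp

/-! ### The alternating summands as Fourier transforms of push-forwards. -/

/-- The parameter domain `(0, ∞)^m × (0, ∞)`. -/
def paramDomain (m : ℕ) : Set ((Fin m → ℝ) × ℝ) :=
  (Set.univ.pi fun _ => Set.Ioi 0) ×ˢ Set.Ioi 0

/-- The weight `∏_k e^{-(k+1) s_k} t^n / n! e^{-t}`. -/
noncomputable def weight {m : ℕ} (n : ℕ) (p : (Fin m → ℝ) × ℝ) : ℂ :=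
  (∏ k : Fin m, Complex.exp (-(((k : ℂ) + 1) * p.1 k))) *
    ((p.2 : ℂ) ^ n / (n.factorial : ℂ) * Complex.exp (-(p.2 : ℂ)))

/-- The point with coordinates `x_{σ j} = ∑_{k ≥ j} s_k - t / 2`. -/
noncomputable def paramPoint {m : ℕ} (σ : Equiv.Perm (Fin m)) (p : (Fin m → ℝ) × ℝ) :
    Fin m → ℝ :=
  fun i => ∑ k ∈ Finset.Ici (σ.symm i), p.1 k - p.2 / 2

theorem measurable_paramPoint {m : ℕ} (σ : Equiv.Perm (Fin m)) : Measurable (paramPoint σ) := by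
  unfold paramPoint
  fun_prop

theorem volume_restrict_paramDomain (m : ℕ) :
    (volume : Measure ((Fin m → ℝ) × ℝ)).restrict (paramDomain m)
      = (Measure.pi fun _ : Fin m => (volume : Measure ℝ).restrict (Set.Ioi 0)).prod
          ((volume : Measure ℝ).restrict (Set.Ioi 0)) := by
  rw [paramDomain, Measure.volume_eq_prod, ← Measure.prod_restrict, volume_pi,
    Measure.restrict_pi_pi]

theorem integrableOn_weight {m : ℕ} (n : ℕ) :
    IntegrableOn (weight n) (paramDomain m) := by
  rw [IntegrableOn, volume_restrict_paramDomain]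
  refine Integrable.mul_prod (f := fun s : Fin m → ℝ =>
    ∏ k : Fin m, Complex.exp (-(((k : ℂ) + 1) * s k))) (g := fun t : ℝ =>
    (t : ℂ) ^ n / (n.factorial : ℂ) * Complex.exp (-(t : ℂ))) ?_ ?_
  · refine Integrable.fintype_prod (f := fun (k : Fin m) (s : ℝ) =>
      Complex.exp (-(((k : ℂ) + 1) * s))) fun k => ?_
    have := integrableOn_pow_mul_exp_neg (P := (k : ℂ) + 1) (by
      simp only [Complex.add_re, Complex.natCast_re, Complex.one_re]; positivity) 0 0
    simpa [IntegrableOn] using this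
  · have := (integrableOn_pow_mul_exp_neg (P := 1) (by simp) n 0).mul_const (n.factorial : ℂ)⁻¹
    refine this.congr (Filter.Eventually.of_forall fun t => ?_)
    simp only [one_mul]
    ring

/-- Exchanging summations moves the tail sums of s onto initial sums of ξ ∘ σ, as the initial-sum
form of Schur's identity requires; the shift by t/2 yields the ∑ ξ_j of `poleFactor`. -/
theorem sum_paramPoint_mul {m : ℕ} (σ : Equiv.Perm (Fin m)) (p : (Fin m → ℝ) × ℝ)
    (ξ : Fin m → ℝ) :
    ∑ j, (paramPoint σ p j : ℂ) * (ξ j : ℂ)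
      = ∑ k, (p.1 k : ℂ) * (∑ j ∈ Finset.Iic k, (ξ (σ j) : ℂ)) - p.2 / 2 * ∑ j, (ξ j : ℂ) := by
  rw [← Equiv.sum_comp σ]
  simp only [paramPoint, Equiv.symm_apply_apply, Complex.ofReal_sub, Complex.ofReal_sum, sub_mul,
    Finset.sum_sub_distrib, Finset.sum_mul, Finset.mul_sum]
  congr 1
  · rw [Finset.sum_sigma', Finset.sum_sigma']
    refine Finset.sum_bij' (fun p _ => ⟨p.2, p.1⟩) (fun p _ => ⟨p.2, p.1⟩) ?_ ?_ ?_ ?_ ?_ <;> simp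
  · rw [Equiv.sum_comp σ (fun j => ((p.2 / 2 : ℝ) : ℂ) * (ξ j : ℂ))]
    simp

/-- The rational function of the integrand as the Fourier transform of a weighted push-forward. -/
theorem integral_weight_mul_exp {m n : ℕ} (hn : n < 3) (σ : Equiv.Perm (Fin m)) (ξ : Fin m → ℝ) :
    ∫ p in paramDomain m, weight n p *
        Complex.exp (-(Complex.I * ∑ j, (paramPoint σ p j : ℂ) * (ξ j : ℂ)))
      = (∏ k, (∑ j ∈ Finset.Iic k, (1 + Complex.I * (ξ (σ j) : ℂ)))⁻¹) *
          (poleFactor ξ)⁻¹ ^ (n + 1) := by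
  have hpole : 0 < (poleFactor ξ).re := by
    have : ∑ j, (ξ j : ℂ) = ((∑ j, ξ j : ℝ) : ℂ) := by push_cast; rfl
    rw [poleFactor, this]
    simp
  have hZ : ∀ k : Fin m, ∑ j ∈ Finset.Iic k, (1 + Complex.I * (ξ (σ j) : ℂ))
      = ((k : ℂ) + 1) + Complex.I * ∑ j ∈ Finset.Iic k, (ξ (σ j) : ℂ) := fun k => by
    rw [Finset.sum_add_distrib, Finset.mul_sum]
    simp
  have hZre : ∀ k : Fin m, 0 < (∑ j ∈ Finset.Iic k, (1 + Complex.I * (ξ (σ j) : ℂ))).re :=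
    fun k => by
      rw [Complex.re_sum]
      exact Finset.sum_pos (fun j _ => by simp) ⟨k, by simp⟩
  -- The variables separate: s_k appears only through e^{-Z_k s_k}, and t only through t^n/n!
  -- e^{-wt}, with w the pole factor.
  have hfac : ∀ p : (Fin m → ℝ) × ℝ, weight n p *
        Complex.exp (-(Complex.I * ∑ j, (paramPoint σ p j : ℂ) * (ξ j : ℂ)))
      = (∏ k, Complex.exp (-((∑ j ∈ Finset.Iic k, (1 + Complex.I * (ξ (σ j) : ℂ))) * p.1 k))) *
        ((p.2 : ℂ) ^ n / (n.factorial : ℂ) * Complex.exp (-(poleFactor ξ * p.2))) := by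
    intro p
    rw [sum_paramPoint_mul, weight]
    simp only [hZ]
    rw [← Complex.exp_sum, ← Complex.exp_sum]
    have : -(Complex.I * (∑ k, (p.1 k : ℂ) * (∑ j ∈ Finset.Iic k, (ξ (σ j) : ℂ))
          - p.2 / 2 * ∑ j, (ξ j : ℂ)))
        = (∑ k : Fin m, (-(((k : ℂ) + 1 + Complex.I * ∑ j ∈ Finset.Iic k, (ξ (σ j) : ℂ)) * p.1 k)
            + ((k : ℂ) + 1) * p.1 k)) + Complex.I * (p.2 / 2 * ∑ j, (ξ j : ℂ)) := by
      rw [mul_sub, neg_sub, sub_eq_add_neg, add_comm, Finset.mul_sum _ _ Complex.I,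
        ← Finset.sum_neg_distrib]
      congr 1
      exact Finset.sum_congr rfl fun k _ => by ring
    have h2 : Complex.exp (-(poleFactor ξ * p.2))
        = Complex.exp (-p.2) * Complex.exp (Complex.I * (p.2 / 2 * ∑ j, (ξ j : ℂ))) := by
      rw [← Complex.exp_add, poleFactor]
      congr 1
      ring
    rw [this, h2, Complex.exp_add, Finset.sum_add_distrib, Complex.exp_add,
      Finset.sum_neg_distrib (f := fun k : Fin m => ((k : ℂ) + 1) * p.1 k), Complex.exp_neg]
    have := Complex.exp_ne_zero (∑ k : Fin m, ((k : ℂ) + 1) * p.1 k)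
    field_simp
  simp only [hfac]
  rw [volume_restrict_paramDomain, integral_prod_mul
    (fun s : Fin m → ℝ =>
      ∏ k, Complex.exp (-((∑ j ∈ Finset.Iic k, (1 + Complex.I * (ξ (σ j) : ℂ))) * s k)))
    (fun t : ℝ => (t : ℂ) ^ n / (n.factorial : ℂ) * Complex.exp (-(poleFactor ξ * t))),
    integral_fintype_prod_eq_prod (fun (k : Fin m) (s : ℝ) =>
      Complex.exp (-((∑ j ∈ Finset.Iic k, (1 + Complex.I * (ξ (σ j) : ℂ))) * s))),
    integral_Ioi_pow_mul_exp_neg hpole hn]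
  congr 1
  · refine Finset.prod_congr rfl fun k _ => ?_
    have := integral_Ioi_pow_mul_exp_neg (hZre k) (n := 0) (by norm_num) 0
    simpa [tailPoly] using this
  · simp [tailPoly_zero_right]

/-! ### Only the identity permutation meets the decreasing cone. -/

theorem strictAnti_paramPoint_comp {m : ℕ} (σ : Equiv.Perm (Fin m)) {p : (Fin m → ℝ) × ℝ}
    (hp : p ∈ paramDomain m) : StrictAnti fun j => paramPoint σ p (σ j) := by
  intro a b hab
  simp only [paramPoint, Equiv.symm_apply_apply]
  have hpos : ∀ k, 0 < p.1 k := fun k => hp.1 k (Set.mem_univ k)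
  have : ∑ k ∈ Finset.Ici b, p.1 k < ∑ k ∈ Finset.Ici a, p.1 k :=
    Finset.sum_lt_sum_of_subset (Finset.Ici_subset_Ici.2 hab.le) (i := a) (by simp) (by simpa)
      (hpos a) fun k _ _ => (hpos k).le
  linarith

/-- The coordinates decrease both along σ and in the natural order, so σ is strictly increasing,
hence trivial. -/
theorem eq_one_of_strictAnti_paramPoint {m : ℕ} {σ : Equiv.Perm (Fin m)}
    {p : (Fin m → ℝ) × ℝ} (hp : p ∈ paramDomain m) (h : StrictAnti (paramPoint σ p)) : σ = 1 := by
  have hmono : StrictMono σ := fun a b hab =>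
    h.lt_iff_gt.1 (strictAnti_paramPoint_comp σ hp hab)
  have hid : (σ : Fin m → Fin m) = id :=
    hmono.range_inj strictMono_id |>.1 (by rw [σ.surjective.range_eq, Set.range_id])
  exact Equiv.ext (congrFun hid)

theorem integral_weight_mul_comp_paramPoint_of_ne_one {m n : ℕ} {σ : Equiv.Perm (Fin m)}
    (hσ : σ ≠ 1) {ψ : (Fin m → ℝ) → ℂ} (hψ : ∀ x, ¬ StrictAnti x → ψ x = 0) :
    ∫ p in paramDomain m, weight n p * ψ (paramPoint σ p) = 0 := by
  have hms : MeasurableSet (paramDomain m) :=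
    (MeasurableSet.univ_pi fun _ => measurableSet_Ioi).prod measurableSet_Ioi
  rw [← integral_zero]
  refine setIntegral_congr_fun hms fun p hp => ?_
  rw [hψ _ fun h => hσ (eq_one_of_strictAnti_paramPoint hp h), mul_zero]

/-! ### Change of variables for the identity permutation. -/

/-- The partial sum matrix, mapping `s` to the vector with coordinates `∑_{k ≥ j} s_k`. -/
def tailSumMatrix (m : ℕ) : Matrix (Fin m) (Fin m) ℝ :=
  Matrix.of fun j k => if j ≤ k then 1 else 0

theorem toLin'_tailSumMatrix_apply {m : ℕ} (s : Fin m → ℝ) (j : Fin m) :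
    Matrix.toLin' (tailSumMatrix m) s j = ∑ k ∈ Finset.Ici j, s k := by
  rw [Matrix.toLin'_apply, Matrix.mulVec, dotProduct, ← Finset.filter_le_eq_Ici, Finset.sum_filter]
  refine Finset.sum_congr rfl fun k _ => ?_
  simp [tailSumMatrix]

theorem det_tailSumMatrix (m : ℕ) : (tailSumMatrix m).det = 1 := by
  rw [Matrix.det_of_isUpperTriangular]
  · simp [tailSumMatrix]
  · intro i j hij
    simp only [id] at hij
    simp [tailSumMatrix, not_le.2 hij]

theorem integral_comp_tailSum_sub {m : ℕ} {g : (Fin m → ℝ) → ℂ} (hg : AEStronglyMeasurable g)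
    (c : Fin m → ℝ) :
    ∫ s, g (Matrix.toLin' (tailSumMatrix m) s - c) = ∫ x, g x := by
  have hmap : Measure.map (Matrix.toLin' (tailSumMatrix m)) volume = volume := by
    rw [Real.map_matrix_volume_pi_eq_smul_volume_pi (by rw [det_tailSumMatrix]; exact one_ne_zero),
      det_tailSumMatrix]
    simp
  rw [← integral_sub_right_eq_self g c]
  conv_rhs => rw [← hmap]
  rw [integral_map]
  · exact (LinearMap.continuous_of_finiteDimensional _).aemeasurable
  · rw [hmap]
    exact hg.comp_quasiMeasurePreserving
      (measurePreserving_sub_right volume c).quasiMeasurePreserving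

theorem sum_sum_Ici {m : ℕ} (s : Fin m → ℝ) :
    ∑ j, ∑ k ∈ Finset.Ici j, s k = ∑ k : Fin m, ((k : ℝ) + 1) * s k := by
  have : ∀ k : Fin m, ((k : ℝ) + 1) * s k = ∑ j ∈ Finset.Iic k, s k := fun k => by simp
  simp only [this]
  rw [Finset.sum_sigma', Finset.sum_sigma']
  refine Finset.sum_bij' (fun p _ => ⟨p.2, p.1⟩) (fun p _ => ⟨p.2, p.1⟩) ?_ ?_ ?_ ?_ ?_ <;> simp

/-- Consecutive tails differ by s_k, so on decreasing vectors the only extra constraint is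
positivity of the last s. -/
theorem pos_of_strictAnti_tailSum {m : ℕ} {s : Fin m → ℝ}
    (h : StrictAnti fun j => ∑ k ∈ Finset.Ici j, s k) {l : Fin m} (hl : ∀ j, j ≤ l)
    (h0 : 0 < s l) (k : Fin m) : 0 < s k := by
  rcases eq_or_lt_of_le (hl k) with rfl | hk
  · exact h0
  · let k' : Fin m := ⟨k + 1, lt_of_le_of_lt (Nat.succ_le_of_lt hk) l.isLt⟩
    have hk' : k < k' := Fin.mk_lt_mk.2 (Nat.lt_succ_self _)
    have hIci : Finset.Ici k = insert k (Finset.Ici k') := by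
      ext j
      simp only [Finset.mem_Ici, Finset.mem_insert, Fin.le_def, Fin.ext_iff, k']
      omega
    have := h hk'
    simp only at this
    rw [hIci, Finset.sum_insert (by simpa using hk')] at this
    linarith

theorem Ici_eq_singleton_of_forall_le {m : ℕ} {l : Fin m} (hl : ∀ j, j ≤ l) :
    Finset.Ici l = {l} := by
  ext j
  simp only [Finset.mem_Ici, Finset.mem_singleton]
  exact ⟨fun h => le_antisymm (hl j) h, fun h => h.ge⟩

/-- With x_j = ∑_{k ≥ j} s_k - t/2 one has ∑ (k+1) s_k = ∑ x_j + mt/2, which accounts for e^{-∑ x_j}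
and the rate (m+2)/2. The condition s_l = x_l + t/2 > 0 becomes t > -2x_l. -/
theorem integral_weight_mul_comp_paramPoint_one {m n : ℕ} {l : Fin m} (hl : ∀ j, j ≤ l)
    {ψ : (Fin m → ℝ) → ℂ} (hc : Continuous ψ) (hcs : HasCompactSupport ψ)
    (hψ : ∀ x, ¬ StrictAnti x → ψ x = 0) :
    ∫ p in paramDomain m, weight n p * ψ (paramPoint 1 p)
      = ∫ x, Complex.exp (-∑ j, (x j : ℂ)) * ψ x *
          ∫ t in Set.Ioi (max 0 (-2 * x l)),
            (t : ℂ) ^ n / (n.factorial : ℂ) * Complex.exp (-(((m : ℂ) + 2) / 2 * t)) := by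
  classical
  -- `A` records only the positivity of the last s; the other constraints are imposed by the
  -- vanishing of ψ off decreasing vectors.
  set A : Set (ℝ × (Fin m → ℝ)) := {p | 0 < p.2 l + p.1 / 2} with hA
  set α : ℝ → ℂ := fun t =>
    (t : ℂ) ^ n / (n.factorial : ℂ) * Complex.exp (-(((m : ℂ) + 2) / 2 * t)) with hα
  set β : (Fin m → ℝ) → ℂ := fun x => Complex.exp (-∑ j, (x j : ℂ)) * ψ x with hβ
  set G : ℝ × (Fin m → ℝ) → ℂ := A.indicator fun p => α p.1 * β p.2 with hG
  have hAm : MeasurableSet A := by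
    refine measurableSet_lt measurable_const ?_
    fun_prop
  have hαi : IntegrableOn α (Set.Ioi 0) := by
    have hre : 0 < (((m : ℂ) + 2) / 2).re := by
      have : ((m : ℂ) + 2) / 2 = (((m : ℝ) + 2) / 2 : ℝ) := by push_cast; rfl
      rw [this, Complex.ofReal_re]
      positivity
    refine ((integrableOn_pow_mul_exp_neg hre n 0).mul_const (n.factorial : ℂ)⁻¹).congr
      (Filter.Eventually.of_forall fun t => ?_)
    simp only [hα]
    ring
  have hβc : Continuous β := by fun_prop
  have hβi : Integrable β := hβc.integrable_of_hasCompactSupport hcs.mul_left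
  have hGi : Integrable G (((volume : Measure ℝ).restrict (Set.Ioi 0)).prod volume) :=
    (Integrable.mul_prod hαi hβi).indicator hAm
  have hpt : ∀ (t : ℝ) (s : Fin m → ℝ),
      (Set.univ.pi fun _ : Fin m => Set.Ioi (0 : ℝ)).indicator
        (fun s => weight n (s, t) * ψ (paramPoint 1 (s, t))) s
      = G (t, Matrix.toLin' (tailSumMatrix m) s - fun _ => t / 2) := by
    intro t s
    set x : Fin m → ℝ := Matrix.toLin' (tailSumMatrix m) s - fun _ => t / 2 with hx
    have hxj : ∀ j, x j = ∑ k ∈ Finset.Ici j, s k - t / 2 := fun j => by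
      rw [hx, Pi.sub_apply, toLin'_tailSumMatrix_apply]
    have hxp : paramPoint 1 (s, t) = x := by
      funext j
      rw [hxj]
      rfl
    have hxl : x l + t / 2 = s l := by
      rw [hxj, Ici_eq_singleton_of_forall_le hl]
      simp
    by_cases hs : s ∈ Set.univ.pi fun _ : Fin m => Set.Ioi (0 : ℝ)
    · have hmem : (t, x) ∈ A := by
        simp only [hA, Set.mem_ofPred_eq, hxl]
        exact hs l (Set.mem_univ l)
      rw [Set.indicator_of_mem hs, hG, Set.indicator_of_mem hmem, hxp]
      have hsum : ∑ j, (x j : ℂ) = ∑ k : Fin m, ((k : ℂ) + 1) * s k - m * (t / 2) := by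
        have h1 : ∑ j, x j = ∑ k : Fin m, ((k : ℝ) + 1) * s k - m * (t / 2) := by
          simp only [hxj, Finset.sum_sub_distrib, sum_sum_Ici]
          simp
        exact_mod_cast congrArg (fun r : ℝ => (r : ℂ)) h1
      simp only [weight, hα, hβ, hsum]
      rw [← Complex.exp_sum, Finset.sum_neg_distrib]
      have : Complex.exp (-∑ k : Fin m, ((k : ℂ) + 1) * s k) * Complex.exp (-(t : ℂ))
          = Complex.exp (-(((m : ℂ) + 2) / 2 * t)) *
            Complex.exp (-(∑ k : Fin m, ((k : ℂ) + 1) * s k - m * (t / 2))) := by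
        rw [← Complex.exp_add, ← Complex.exp_add]
        congr 1
        ring
      linear_combination (t : ℂ) ^ n / (n.factorial : ℂ) * ψ x * this
    · rw [Set.indicator_of_notMem hs]
      by_cases hmem : (t, x) ∈ A
      · have hsl : 0 < s l := by simpa only [hA, Set.mem_ofPred_eq, hxl] using hmem
        have hnot : ¬ StrictAnti x := fun h => hs fun k _ => by
          refine pos_of_strictAnti_tailSum (fun a b hab => ?_) hl hsl k
          have := h hab
          rw [hxj, hxj] at this
          simpa using this
        rw [hG, Set.indicator_of_mem hmem]
        simp [hβ, hψ x hnot]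
      · rw [hG, Set.indicator_of_notMem hmem]
  have hpi : MeasurableSet (Set.univ.pi fun _ : Fin m => Set.Ioi (0 : ℝ)) :=
    MeasurableSet.univ_pi fun _ => measurableSet_Ioi
  have hGm : ∀ t, AEStronglyMeasurable (fun x => G (t, x)) := by
    intro t
    have h1 : Measurable fun p : ℝ × (Fin m → ℝ) => α p.1 * β p.2 := by
      have : Measurable α := by fun_prop
      have := hβc.measurable
      fun_prop
    exact ((h1.indicator hAm).comp (measurable_const.prodMk measurable_id)).aestronglyMeasurable
  have hfi : IntegrableOn (fun p : (Fin m → ℝ) × ℝ => weight n p * ψ (paramPoint 1 p))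
      (paramDomain m) := by
    obtain ⟨C, hC⟩ := hc.bounded_above_of_compact_support hcs
    exact (integrableOn_weight n).mul_bdd (c := C)
      (hc.measurable.comp (measurable_paramPoint 1)).aestronglyMeasurable
      (Filter.Eventually.of_forall fun p => hC _)
  rw [paramDomain, Measure.volume_eq_prod, ← Measure.prod_restrict, integral_prod_symm]
  swap
  · rwa [Measure.prod_restrict, ← Measure.volume_eq_prod, ← paramDomain]
  calc _ = ∫ t in Set.Ioi (0 : ℝ), ∫ x, G (t, x) := by
        refine integral_congr_ae (Filter.Eventually.of_forall fun t => ?_)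
        simp only
        rw [← integral_indicator hpi]
        simp only [hpt]
        exact integral_comp_tailSum_sub (hGm t) _
    _ = ∫ x, ∫ t in Set.Ioi (0 : ℝ), G (t, x) := integral_integral_swap hGi
    _ = _ := by
        refine integral_congr_ae (Filter.Eventually.of_forall fun x => ?_)
        simp only
        have hset : {t : ℝ | (t, x) ∈ A} ∩ Set.Ioi 0 = Set.Ioi (max 0 (-2 * x l)) := by
          ext t
          simp only [hA, Set.mem_ofPred_eq, Set.mem_inter_iff, Set.mem_Ioi, max_lt_iff]
          constructor
          · rintro ⟨h1, h2⟩
            exact ⟨h2, by linarith⟩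
          · rintro ⟨h1, h2⟩
            exact ⟨by linarith, h1⟩
        have hm' : MeasurableSet {t : ℝ | (t, x) ∈ A} :=
          hAm.preimage (measurable_id.prodMk measurable_const)
        have : (fun t => G (t, x)) = {t : ℝ | (t, x) ∈ A}.indicator fun t => α t * β x := by
          funext t
          simp only [hG, Set.indicator_apply, Set.mem_ofPred_eq]
        rw [this, integral_indicator hm', Measure.restrict_restrict hm', hset, integral_mul_const,
          mul_comm]

/-! ### The distributional value of the ξ-integrals. -/

theorem integral_rational_mul_fourier {m n : ℕ} (hn : n < 3) {l : Fin m} (hl : ∀ j, j ≤ l)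
    {ψ : (Fin m → ℝ) → ℂ} (h1 : ContDiff ℝ ∞ ψ) (h2 : HasCompactSupport ψ)
    (hψ : ∀ x, ¬ StrictAnti x → ψ x = 0) :
    Integrable (fun ξ : Fin m → ℝ => (vandermonde ξ : ℂ)
        / (∏ j, ∏ k ∈ Finset.Ici j, (1 + Complex.I / 2 * ((ξ j : ℂ) + (ξ k : ℂ))))
        * (poleFactor ξ)⁻¹ ^ (n + 1)
        * ∫ x, Complex.exp (Complex.I * ∑ j, (x j : ℂ) * (ξ j : ℂ)) * ψ x) ∧
    ∫ ξ : Fin m → ℝ, (vandermonde ξ : ℂ)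
        / (∏ j, ∏ k ∈ Finset.Ici j, (1 + Complex.I / 2 * ((ξ j : ℂ) + (ξ k : ℂ))))
        * (poleFactor ξ)⁻¹ ^ (n + 1)
        * ∫ x, Complex.exp (Complex.I * ∑ j, (x j : ℂ) * (ξ j : ℂ)) * ψ x
      = (2 * Complex.I) ^ (m * (m - 1) / 2) * ((2 * Real.pi : ℂ) ^ m *
          ∫ x, Complex.exp (-∑ j, (x j : ℂ)) * ψ x *
            (tailPoly n (((m : ℂ) + 2) / 2) ((max 0 (-2 * x l) : ℝ) : ℂ) *
              Complex.exp (-(((m : ℂ) + 2) / 2 * ((max 0 (-2 * x l) : ℝ) : ℂ))))) := by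
  have key := fun σ : Equiv.Perm (Fin m) =>
    integral_fourier_weight_mul (integrableOn_weight (m := m) n) (measurable_paramPoint σ) h1 h2
  simp only [integral_weight_mul_exp hn] at key
  have hrw : ∀ ξ : Fin m → ℝ, (vandermonde ξ : ℂ)
        / (∏ j, ∏ k ∈ Finset.Ici j, (1 + Complex.I / 2 * ((ξ j : ℂ) + (ξ k : ℂ))))
        * (poleFactor ξ)⁻¹ ^ (n + 1)
        * ∫ x, Complex.exp (Complex.I * ∑ j, (x j : ℂ) * (ξ j : ℂ)) * ψ x
      = (2 * Complex.I) ^ (m * (m - 1) / 2) *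
        ∑ σ : Equiv.Perm (Fin m), ((Equiv.Perm.sign σ : ℤ) : ℂ) *
          ((∏ k, (∑ j ∈ Finset.Iic k, (1 + Complex.I * (ξ (σ j) : ℂ)))⁻¹) *
            (poleFactor ξ)⁻¹ ^ (n + 1) *
            ∫ x, Complex.exp (Complex.I * ∑ j, (x j : ℂ) * (ξ j : ℂ)) * ψ x) := by
    intro ξ
    rw [vandermonde_div_prod_eq, mul_assoc, mul_assoc, Finset.sum_mul]
    congr 1
    exact Finset.sum_congr rfl fun σ _ => by ring
  simp only [hrw]
  constructor
  · exact (integrable_finsetSum _ fun σ _ => (key σ).1.const_mul _).const_mul _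
  · rw [integral_const_mul, integral_finsetSum _ fun σ _ => (key σ).1.const_mul _]
    congr 1
    rw [Finset.sum_eq_single 1]
    · rw [integral_const_mul, (key 1).2,
        integral_weight_mul_comp_paramPoint_one hl h1.continuous h2 hψ]
      have hre : 0 < (((m : ℂ) + 2) / 2).re := by
        have : ((m : ℂ) + 2) / 2 = (((m : ℝ) + 2) / 2 : ℝ) := by push_cast; rfl
        rw [this, Complex.ofReal_re]
        positivity
      simp only [integral_Ioi_pow_mul_exp_neg hre hn]
      simp
    · intro σ _ hσ
      rw [integral_const_mul, (key σ).2, integral_weight_mul_comp_paramPoint_of_ne_one hσ hψ]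
      simp
    · simp

theorem F_diagonal {m : ℕ} (x : Fin m → ℝ) :
    F (Matrix.diagonal x) = 1 - 4 * (∑ j, x j) / ((m : ℝ) * (m + 1))
      + (4 * (∑ j, x j) ^ 2 + 8 * ∑ j, x j ^ 2) / ((m : ℝ) * (m + 1) * (m + 2) * (m + 3)) := by
  rw [F, Matrix.diagonal_pow, Matrix.trace_diagonal, Matrix.trace_diagonal]
  rfl

/-- The coefficient of the simple additional pole in `kernelI`. -/
noncomputable def simplePoleCoeff {m : ℕ} (x : Fin m → ℝ) : ℂ :=
  4 * (∑ j, (x j : ℂ)) / ((m : ℂ) * (m + 1) * (m + 3)) - 2 / ((m : ℂ) + 1)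

/-- The coefficient of the double additional pole in `kernelI`. -/
noncomputable def doublePoleCoeff (m : ℕ) : ℂ := 2 / (((m : ℂ) + 1) * (m + 3))

/-- Sorted by powers of the pole factor, the x-dependence outside the exponential sits in polynomial
coefficients, which can be absorbed into the test function. -/
theorem xiIntegrand_eq {m : ℕ} (x ξ : Fin m → ℝ) :
    xiIntegrand x ξ = (vandermonde ξ : ℂ)
        / (∏ j, ∏ k ∈ Finset.Ici j, (1 + Complex.I / 2 * ((ξ j : ℂ) + (ξ k : ℂ))))
        * Complex.exp (Complex.I * ∑ j, (x j : ℂ) * (ξ j : ℂ)) *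
        ((F (Matrix.diagonal x) : ℂ) * (poleFactor ξ)⁻¹ ^ (0 + 1)
          + simplePoleCoeff x * (poleFactor ξ)⁻¹ ^ (1 + 1)
          + doublePoleCoeff m * (poleFactor ξ)⁻¹ ^ (2 + 1)) := by
  rw [xiIntegrand, kernelI, ← simplePoleCoeff, doublePoleCoeff, div_mul_eq_div_div 2]
  generalize simplePoleCoeff x = b
  generalize (2 / (((m : ℂ) + 1) * (m + 3)) : ℂ) = c
  simp only [div_eq_mul_inv, mul_inv, inv_pow]
  ring

/-- For q = m the last coordinate is positive and the t-integral starts at 0; for q > m it is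
negative, the start is -2x_m, and the exponential becomes e^{(m+2)x_m}. -/
theorem calI_eq {m q : ℕ} (hm : 1 ≤ m) (hmq : m ≤ q) {x : Fin m → ℝ}
    (hx : x ∈ chamber m (2 * m - q)) :
    (calI hm q x : ℂ) = ∑ n : Fin 3,
      ![(F (Matrix.diagonal x) : ℂ), simplePoleCoeff x, doublePoleCoeff m] n *
        (tailPoly n (((m : ℂ) + 2) / 2)
          ((max 0 (-2 * x ⟨m - 1, Nat.sub_one_lt_of_le hm le_rfl⟩) : ℝ) : ℂ) *
        Complex.exp (-(((m : ℂ) + 2) / 2 *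
          ((max 0 (-2 * x ⟨m - 1, Nat.sub_one_lt_of_le hm le_rfl⟩) : ℝ) : ℂ)))) := by
  have hm0 : (m : ℂ) ≠ 0 := by exact_mod_cast (by omega : m ≠ 0)
  have hm1 : (m : ℂ) + 1 ≠ 0 := by exact_mod_cast (by omega : m + 1 ≠ 0)
  have hm2 : (m : ℂ) + 2 ≠ 0 := by exact_mod_cast (by omega : m + 2 ≠ 0)
  have hm3 : (m : ℂ) + 3 ≠ 0 := by exact_mod_cast (by omega : m + 3 ≠ 0)
  set l : Fin m := ⟨m - 1, Nat.sub_one_lt_of_le hm le_rfl⟩ with hl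
  rw [Fin.sum_univ_three]
  simp only [Matrix.cons_val_zero, Matrix.cons_val_one, Matrix.cons_val_two, Matrix.head_cons,
    Matrix.tail_cons, Fin.val_zero, Fin.val_one, Fin.val_two, simplePoleCoeff,
    doublePoleCoeff]
  rw [calI]
  split_ifs with hqm
  · have hxl : 0 < x l := hx.2.1 l (by simp only [hl]; omega)
    rw [max_eq_left (by linarith)]
    simp only [Complex.ofReal_zero, tailPoly_zero_right, mul_zero, neg_zero, Complex.exp_zero,
      mul_one, calImin]
    push_cast
    field_simp
    ring
  · have hxl : x l < 0 := hx.2.2 l (by simp only [hl]; omega)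
    rw [max_eq_right (by linarith)]
    have hexp : Complex.exp (-(((m : ℂ) + 2) / 2 * ((-2 * x l : ℝ) : ℂ)))
        = ((Real.exp (((m : ℝ) + 2) * x l) : ℝ) : ℂ) := by
      push_cast
      congr 1
      ring
    rw [hexp, calIexp]
    simp only [tailPoly, Finset.sum_range_succ, Finset.sum_range_zero, Nat.factorial]
    push_cast
    field_simp
    ring

theorem not_mem_of_tsupport_subset {m : ℕ} {U : Set (Fin m → ℝ)} {φ : (Fin m → ℝ) → ℂ}
    (h : tsupport φ ⊆ U) {x : Fin m → ℝ} (hx : x ∉ U) : φ x = 0 :=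
  image_eq_zero_of_notMem_tsupport fun h' => hx (h h')

theorem continuous_calI {m : ℕ} (hm : 1 ≤ m) (q : ℕ) : Continuous (calI hm q) := by
  unfold calI calImin calIexp
  simp only [F_diagonal]
  split_ifs <;> fun_prop

theorem isXiIntegralOn_chamber {m q : ℕ} (hm : 1 ≤ m) (hmq : m ≤ q) :
    IsXiIntegralOn (chamber m (2 * m - q)) (fun x : Fin m → ℝ =>
      Complex.I ^ (m * (m - 1) / 2) * 2 ^ (m * (m + 1) / 2) * (Real.pi : ℂ) ^ m
        * ((calI hm q x * Real.exp (-∑ j, x j) : ℝ) : ℂ)) := by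
  have hcalI := continuous_calI hm q
  refine ⟨(Continuous.locallyIntegrable (by fun_prop)).locallyIntegrableOn _, ?_⟩
  intro φ hφ hφc hφs
  set l : Fin m := ⟨m - 1, Nat.sub_one_lt_of_le hm le_rfl⟩ with hl
  have hlast : ∀ j, j ≤ l := fun j => Fin.le_def.2 (by simp only [hl]; omega)
  let a : Fin 3 → (Fin m → ℝ) → ℂ := ![fun x => (F (Matrix.diagonal x) : ℂ), simplePoleCoeff,
    fun _ => doublePoleCoeff m]
  have ha : ∀ n, ContDiff ℝ ∞ (a n) := by
    have hcoe : ContDiff ℝ ∞ (fun t : ℝ => (t : ℂ)) := Complex.ofRealCLM.contDiff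
    intro n
    fin_cases n
    · simp only [a, Fin.zero_eta, Matrix.cons_val_zero, F_diagonal]
      exact hcoe.comp (by fun_prop)
    · simp only [a, Fin.mk_one, Matrix.cons_val_one]
      unfold simplePoleCoeff
      have : ContDiff ℝ ∞ fun x : Fin m → ℝ => ∑ j, (x j : ℂ) :=
        ContDiff.sum fun j _ => hcoe.comp (contDiff_apply ℝ ℝ j)
      exact ((contDiff_const.mul this).div_const _).sub contDiff_const
    · exact contDiff_const
  have hψ1 : ∀ n, ContDiff ℝ ∞ fun x => a n x * φ x := fun n => (ha n).mul hφ
  have hψ2 : ∀ n, HasCompactSupport fun x => a n x * φ x := fun n => hφc.mul_left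
  have hψ3 : ∀ n x, ¬ StrictAnti x → a n x * φ x = 0 := fun n x hx => by
    rw [not_mem_of_tsupport_subset hφs fun h => hx h.1, mul_zero]
  have key := fun n : Fin 3 => integral_rational_mul_fourier n.isLt hlast (hψ1 n) (hψ2 n) (hψ3 n)
  have hinner : ∀ ξ : Fin m → ℝ, ∫ x, xiIntegrand x ξ * φ x
      = ∑ n : Fin 3, (vandermonde ξ : ℂ)
        / (∏ j, ∏ k ∈ Finset.Ici j, (1 + Complex.I / 2 * ((ξ j : ℂ) + (ξ k : ℂ))))
        * (poleFactor ξ)⁻¹ ^ ((n : ℕ) + 1)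
        * ∫ x, Complex.exp (Complex.I * ∑ j, (x j : ℂ) * (ξ j : ℂ)) * (a n x * φ x) := by
    intro ξ
    simp only [← integral_const_mul]
    rw [← integral_finsetSum]
    · refine integral_congr_ae (Filter.Eventually.of_forall fun x => ?_)
      simp only [xiIntegrand_eq, Fin.sum_univ_three, a, Matrix.cons_val_zero, Matrix.cons_val_one,
        Matrix.cons_val, Fin.val_zero, Fin.val_one, Fin.val_two]
      ring
    · intro n _
      refine Integrable.const_mul ?_ _
      have := (hψ1 n).continuous
      exact Continuous.integrable_of_hasCompactSupport (by fun_prop) (hψ2 n).mul_left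
  simp only [hinner]
  constructor
  · exact integrable_finsetSum _ fun n _ => (key n).1
  · rw [integral_finsetSum _ fun n _ => (key n).1, Finset.sum_congr rfl fun n _ => (key n).2]
    simp only [← mul_assoc, ← integral_const_mul]
    have htail : ∀ n : Fin 3, Continuous fun T : ℂ => tailPoly n (((m : ℂ) + 2) / 2) T := by
      intro n
      unfold tailPoly
      fun_prop
    rw [← integral_finsetSum]
    · refine integral_congr_ae (Filter.Eventually.of_forall fun x => ?_)
      simp only
      -- Off the chamber the two expressions may differ, but φ vanishes there.
      by_cases hx : x ∈ chamber m (2 * m - q)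
      · have hc := calI_eq hm hmq hx
        have hN : m * (m + 1) / 2 = m * (m - 1) / 2 + m := by
          obtain ⟨k, rfl⟩ : ∃ k, m = k + 1 := ⟨m - 1, by omega⟩
          rw [Nat.add_sub_cancel, ← Nat.add_mul_div_right _ _ two_pos]
          congr 1
          ring
        rw [Complex.ofReal_mul, hc, hN, Fin.sum_univ_three, Fin.sum_univ_three]
        simp only [a, Matrix.cons_val_zero, Matrix.cons_val_one,
          Matrix.cons_val, Fin.val_zero, Fin.val_one, Fin.val_two]
        push_cast
        rw [mul_pow, mul_pow, pow_add]
        ring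
      · simp [not_mem_of_tsupport_subset hφs hx]
    · intro n _
      have h1 := (ha n).continuous
      have h2 := hφ.continuous
      have h3 := htail n
      refine Continuous.integrable_of_hasCompactSupport (by fun_prop)
        (hφc.mono fun x hx h0 => hx ?_)
      simp only [h0, mul_zero, zero_mul]

/-! ### Absolute convergence over the chamber. -/

theorem isOpen_chamber (m p : ℕ) : IsOpen (chamber m p) := by
  have h : chamber m p = (⋂ i : Fin m, ⋂ j : Fin m, {x | i < j → x j < x i}) ∩
      ((⋂ j : Fin m, {x | (j : ℕ) < p → 0 < x j}) ∩ ⋂ j : Fin m, {x | p ≤ (j : ℕ) → x j < 0}) := by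
    ext x
    simp only [chamber, StrictAnti, Set.mem_inter_iff, Set.mem_iInter, Set.mem_ofPred_eq]
  have himp : ∀ (P : Prop) (f g : (Fin m → ℝ) → ℝ), Continuous f → Continuous g →
      IsOpen {x | P → f x < g x} := fun P f g hf hg => by
    by_cases hP : P
    · simpa [hP] using isOpen_lt hf hg
    · simp [hP]
  rw [h]
  refine (isOpen_iInter_of_finite fun i => isOpen_iInter_of_finite fun j => himp _ _ _ ?_ ?_).inter
    ((isOpen_iInter_of_finite fun j => himp _ _ _ ?_ ?_).inter
      (isOpen_iInter_of_finite fun j => himp _ _ _ ?_ ?_)) <;> fun_prop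

theorem hasTemperateGrowth_prod {ι E : Type*} [NormedAddCommGroup E] [NormedSpace ℝ E]
    (s : Finset ι) {f : ι → E → ℝ} (hf : ∀ i ∈ s, (f i).HasTemperateGrowth) :
    (fun x => ∏ i ∈ s, f i x).HasTemperateGrowth := by
  classical
  induction s using Finset.induction_on with
  | empty => simp [Function.HasTemperateGrowth.const]
  | insert a s ha ih =>
    simp only [Finset.prod_insert ha]
    exact (hf a (by simp)).mul (ih fun i hi => hf i (by simp [hi]))

/-- Half of the exponent absorbs the polynomial growth via y^k/k! ≤ e^y; the other half is a product
of integrable one-variable functions. -/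
theorem integrable_mul_exp_neg_sum_abs {m : ℕ} {p : (Fin m → ℝ) → ℝ} (hp : p.HasTemperateGrowth)
    {c : ℝ} (hc : 0 < c) : Integrable fun x => p x * Real.exp (-(c * ∑ j, |x j|)) := by
  obtain ⟨k, C, hC⟩ := hp.2 0
  simp only [norm_iteratedFDeriv_zero] at hC
  have hcont := hp.1.continuous
  have hexp1 : Integrable fun t : ℝ => Real.exp (-(c / 2 * |t|)) := by
    rw [← integrableOn_univ, ← Set.Iic_union_Ioi (a := (0 : ℝ))]
    refine IntegrableOn.union ?_ ?_
    · refine (integrableOn_exp_mul_Iic (a := c / 2) (by linarith) 0).congr_fun (fun t ht => ?_)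
        measurableSet_Iic
      simp only [abs_of_nonpos (Set.mem_Iic.1 ht), mul_neg, neg_neg]
    · refine (integrableOn_exp_mul_Ioi (a := -(c / 2)) (by linarith) 0).congr_fun (fun t ht => ?_)
        measurableSet_Ioi
      simp only [abs_of_pos (Set.mem_Ioi.1 ht), neg_mul]
  have hexp : Integrable fun x : Fin m → ℝ => Real.exp (-(c / 2 * ∑ j, |x j|)) := by
    have := Integrable.fintype_prod (fun _ : Fin m => hexp1)
    rw [← volume_pi] at this
    refine this.congr (Filter.Eventually.of_forall fun x => ?_)
    simp only
    rw [← Real.exp_sum, Finset.mul_sum, Finset.sum_neg_distrib]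
  refine (hexp.const_mul (C * ((2 / c) ^ k * k.factorial * Real.exp (c / 2)))).mono'
    (Continuous.aestronglyMeasurable (by fun_prop)) (Filter.Eventually.of_forall fun x => ?_)
  have hC0 : 0 ≤ C := by
    have := (norm_nonneg _).trans (hC 0)
    simpa using this
  have hnorm : ‖x‖ ≤ ∑ j, |x j| := by
    refine (pi_norm_le_iff_of_nonneg (Finset.sum_nonneg fun j _ => abs_nonneg _)).2 fun j => ?_
    exact Finset.single_le_sum (f := fun j => |x j|) (fun j _ => abs_nonneg _) (Finset.mem_univ j)
  set S := ∑ j, |x j| with hS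
  have hS0 : 0 ≤ S := Finset.sum_nonneg fun j _ => abs_nonneg _
  have hpow : (1 + ‖x‖) ^ k ≤ (2 / c) ^ k * k.factorial * (Real.exp (c / 2) *
      Real.exp (c / 2 * S)) := by
    have h1 : (1 + ‖x‖) ^ k ≤ (1 + S) ^ k := by gcongr
    have h2 := Real.pow_div_factorial_le_exp (c / 2 * (1 + S)) (by positivity) k
    rw [← Real.exp_add, show c / 2 + c / 2 * S = c / 2 * (1 + S) by ring]
    rw [div_le_iff₀ (by positivity), mul_pow] at h2
    calc (1 + ‖x‖) ^ k ≤ (1 + S) ^ k := h1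
      _ = (2 / c) ^ k * ((c / 2) ^ k * (1 + S) ^ k) := by
        rw [← mul_assoc, ← mul_pow, show 2 / c * (c / 2) = 1 by field_simp, one_pow, one_mul]
      _ ≤ (2 / c) ^ k * (Real.exp (c / 2 * (1 + S)) * k.factorial) := by gcongr
      _ = _ := by ring
  calc ‖p x * Real.exp (-(c * S))‖ = ‖p x‖ * Real.exp (-(c * S)) := by
        rw [norm_mul, Real.norm_of_nonneg (Real.exp_pos _).le]
    _ ≤ (C * ((2 / c) ^ k * k.factorial * (Real.exp (c / 2) * Real.exp (c / 2 * S)))) *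
        Real.exp (-(c * S)) := by
        gcongr
        exact (hC x).trans (by gcongr)
    _ = C * ((2 / c) ^ k * k.factorial * Real.exp (c / 2)) *
        (Real.exp (c / 2 * S) * Real.exp (-(c * S))) := by ring
    _ = _ := by
        rw [← Real.exp_add]
        congr 2
        ring

theorem hasTemperateGrowth_apply {m : ℕ} (j : Fin m) :
    (fun x : Fin m → ℝ => x j).HasTemperateGrowth :=
  (ContinuousLinearMap.proj (R := ℝ) (φ := fun _ : Fin m => ℝ) j).hasTemperateGrowth

theorem hasTemperateGrowth_vandermonde (m : ℕ) :
    (fun x : Fin m → ℝ => vandermonde x).HasTemperateGrowth :=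
  hasTemperateGrowth_prod _ fun i _ => hasTemperateGrowth_prod _ fun j _ =>
    (hasTemperateGrowth_apply i).sub (hasTemperateGrowth_apply j)

theorem hasTemperateGrowth_sum_apply (m : ℕ) :
    (fun x : Fin m → ℝ => ∑ j, x j).HasTemperateGrowth :=
  Function.HasTemperateGrowth.sum fun j _ => hasTemperateGrowth_apply j

theorem hasTemperateGrowth_F_diagonal (m : ℕ) :
    (fun x : Fin m → ℝ => F (Matrix.diagonal x)).HasTemperateGrowth := by
  have h1 := hasTemperateGrowth_sum_apply m
  have h2 : (fun x : Fin m → ℝ => ∑ j, x j ^ 2).HasTemperateGrowth :=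
    Function.HasTemperateGrowth.sum fun j _ => (hasTemperateGrowth_apply j).pow 2
  simp only [F_diagonal, div_eq_mul_inv, pow_two (∑ j, _)]
  fun_prop

/-- The last coordinate controls the exponent on the chambers with a negative coordinate. -/
theorem sum_abs_le_of_lt_zero {m : ℕ} {x : Fin m → ℝ} (hx : StrictAnti x) {l : Fin m}
    (hl : ∀ j, j ≤ l) (h0 : x l < 0) :
    (m : ℝ)⁻¹ * ∑ j, |x j| ≤ ∑ j, x j - ((m : ℝ) + 2) * x l := by
  have hm : 1 ≤ (m : ℝ) := by exact_mod_cast (Nat.succ_le_of_lt (Fin.pos l))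
  have h1 : ∀ j, |x j| ≤ (x j - x l) - x l := fun j => by
    have := hx.antitone (hl j)
    exact abs_le.2 ⟨by linarith, by linarith⟩
  have h2 : ∑ j, |x j| ≤ ∑ j, (x j - x l) - m * x l := by
    refine (Finset.sum_le_sum fun j _ => h1 j).trans ?_
    rw [Finset.sum_sub_distrib (f := fun j => x j - x l)]
    simp
  have h3 : 0 ≤ ∑ j, (x j - x l) := Finset.sum_nonneg fun j _ =>
    sub_nonneg.2 (hx.antitone (hl j))
  have h4 : ∑ j, x j - ((m : ℝ) + 2) * x l = ∑ j, (x j - x l) - 2 * x l := by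
    rw [Finset.sum_sub_distrib]
    simp
    ring
  -- With D = ∑ (x_j - x_l) ≥ 0 and x_l < 0, the claim is D - m x_l ≤ m(D - 2x_l), true as m ≥ 1.
  rw [h4, inv_mul_le_iff₀ (by linarith)]
  nlinarith

theorem integrableOn_calI {m q : ℕ} (hm : 1 ≤ m) (hmq : m ≤ q) :
    IntegrableOn (fun x : Fin m → ℝ =>
      calI hm q x * vandermonde x * (∏ j, |x j|) * Real.exp (-∑ j, x j))
      (chamber m (2 * m - q)) := by
  set l : Fin m := ⟨m - 1, Nat.sub_one_lt_of_le hm le_rfl⟩ with hl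
  have hlast : ∀ j, j ≤ l := fun j => Fin.le_def.2 (by simp only [hl]; omega)
  have hm1 : 1 ≤ (m : ℝ) := by exact_mod_cast hm
  -- Both cases take the form polynomial times e^E: E = 0 on the positive chamber, and E = (m+2)x_l
  -- otherwise, where it offsets the growth of e^{-∑ x_j} in negative directions.
  obtain ⟨p, E, hp, hpE, hE⟩ : ∃ p E : (Fin m → ℝ) → ℝ, p.HasTemperateGrowth ∧
      (∀ x, calI hm q x = p x * Real.exp (E x)) ∧
      ∀ x ∈ chamber m (2 * m - q), (m : ℝ)⁻¹ * ∑ j, |x j| ≤ ∑ j, x j - E x := by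
    have hF := hasTemperateGrowth_F_diagonal m
    have hS := hasTemperateGrowth_sum_apply m
    have hx := hasTemperateGrowth_apply l
    by_cases hqm : q = m
    · refine ⟨calImin, 0, ?_, fun x => by simp [calI, hqm], fun x hxc => ?_⟩
      · unfold calImin
        simp only [div_eq_mul_inv]
        fun_prop
      · have : ∑ j, |x j| = ∑ j, x j := Finset.sum_congr rfl fun j _ =>
          abs_of_pos (hxc.2.1 j (by have := j.isLt; omega))
        rw [← this, Pi.zero_apply, sub_zero]
        exact mul_le_of_le_one_left (Finset.sum_nonneg fun j _ => abs_nonneg _)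
          (inv_le_one_of_one_le₀ hm1)
    · refine ⟨fun x => (2 * F (Matrix.diagonal x) / (m + 2)
        + 8 * (((m : ℝ) + 2) ^ 2 * x l ^ 2 - 2 * ((m : ℝ) + 2) * x l + 2)
          / (((m : ℝ) + 1) * (m + 2) ^ 3 * (m + 3))
        - 4 * (((m : ℝ) + 2) * x l - 1) / ((m : ℝ) + 2) ^ 2
          * (4 * (∑ j, x j) / ((m : ℝ) * (m + 1) * (m + 3)) - 2 / ((m : ℝ) + 1))),
        fun x => ((m : ℝ) + 2) * x l, ?_, fun x => by simp only [calI, hqm, if_false, calIexp, hl],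
        fun x hxc => sum_abs_le_of_lt_zero hxc.1 hlast (hxc.2.2 l (by simp only [hl]; omega))⟩
      have hgen : ∀ y : (Fin m → ℝ) → ℝ, y.HasTemperateGrowth →
          (fun x => 2 * F (Matrix.diagonal x) * ((m : ℝ) + 2)⁻¹
            + 8 * (((m : ℝ) + 2) ^ 2 * (y x * y x) - 2 * ((m : ℝ) + 2) * y x + 2)
              * (((m : ℝ) + 1) * (m + 2) ^ 3 * (m + 3))⁻¹
            - 4 * (((m : ℝ) + 2) * y x - 1) * (((m : ℝ) + 2) ^ 2)⁻¹
              * (4 * (∑ j, x j) * ((m : ℝ) * (m + 1) * (m + 3))⁻¹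
                - 2 * ((m : ℝ) + 1)⁻¹)).HasTemperateGrowth := fun y hy => by fun_prop
      simpa only [div_eq_mul_inv, pow_two (_ : ℝ)] using hgen _ hx
  have hP : (fun x => p x * vandermonde x * ∏ j, x j).HasTemperateGrowth :=
    (hp.mul (hasTemperateGrowth_vandermonde m)).mul
      (hasTemperateGrowth_prod _ fun j _ => hasTemperateGrowth_apply j)
  have hdom := (integrable_mul_exp_neg_sum_abs hP (c := (m : ℝ)⁻¹) (by positivity)).norm
  have hcont := continuous_calI hm q
  have hcv : Continuous fun x : Fin m → ℝ => vandermonde x :=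
    (hasTemperateGrowth_vandermonde m).1.continuous
  refine hdom.integrableOn.mono' (Continuous.aestronglyMeasurable (by fun_prop)) ?_
  filter_upwards [ae_restrict_mem (isOpen_chamber m (2 * m - q)).measurableSet] with x hx
  rw [hpE, ← Finset.abs_prod]
  simp only [norm_mul, Real.norm_eq_abs, abs_abs, Real.abs_exp]
  have h1 : Real.exp (E x) * Real.exp (-∑ j, x j) ≤ Real.exp (-((m : ℝ)⁻¹ * ∑ j, |x j|)) := by
    rw [← Real.exp_add]
    exact Real.exp_le_exp.2 (by linarith [hE x hx])
  calc _ = |p x| * |vandermonde x| * |∏ j, x j| * (Real.exp (E x) * Real.exp (-∑ j, x j)) := by ring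
    _ ≤ _ := by gcongr

/-! ### Uniqueness of the distributional value, and β. -/

theorem integrable_mul_of_locallyIntegrableOn {m : ℕ} {U : Set (Fin m → ℝ)}
    {f φ : (Fin m → ℝ) → ℂ} (hf : LocallyIntegrableOn f U) (hφ : Continuous φ)
    (hc : HasCompactSupport φ) (hs : tsupport φ ⊆ U) : Integrable fun x => f x * φ x := by
  have h1 : IntegrableOn f (tsupport φ) := hf.integrableOn_compact_subset hs hc
  obtain ⟨C, hC⟩ := hφ.bounded_above_of_compact_support hc
  have h2 : IntegrableOn (fun x => f x * φ x) (tsupport φ) :=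
    h1.mul_bdd (c := C) hφ.aestronglyMeasurable (Filter.Eventually.of_forall hC)
  refine (integrableOn_iff_integrable_of_support_subset fun x hx => ?_).1 h2
  exact subset_tsupport φ fun h => hx (by simp [h])

/-- The difference of two candidates integrates to zero against every test function. This makes the
choice in `xiIntegral` immaterial under an integral over U. -/
theorem IsXiIntegralOn.ae_eq {m : ℕ} {U : Set (Fin m → ℝ)} (hU : IsOpen U)
    {f g : (Fin m → ℝ) → ℂ} (hf : IsXiIntegralOn U f) (hg : IsXiIntegralOn U g) :
    ∀ᵐ x, x ∈ U → f x = g x := by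
  have h := hU.ae_eq_zero_of_integral_contDiff_smul_eq_zero (μ := volume)
    (hf.1.sub hg.1) fun φ hφ hφc hφs => by
      have hs : tsupport (fun x => (φ x : ℂ)) ⊆ U := by
        refine (closure_mono fun x hx => ?_).trans hφs
        simpa using hx
      have hd : ContDiff ℝ ∞ fun x => (φ x : ℂ) := Complex.ofRealCLM.contDiff.comp hφ
      have hc : HasCompactSupport fun x => (φ x : ℂ) := hφc.comp_left Complex.ofReal_zero
      have h1 := integrable_mul_of_locallyIntegrableOn hf.1 hd.continuous hc hs
      have h2 := integrable_mul_of_locallyIntegrableOn hg.1 hd.continuous hc hs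
      calc _ = ∫ x, (f x * (φ x : ℂ) - g x * (φ x : ℂ)) := by
            refine integral_congr_ae (Filter.Eventually.of_forall fun x => ?_)
            simp only [Pi.sub_apply, Complex.real_smul]
            ring
        _ = 0 := by
            rw [integral_sub h1 h2, (hf.2 _ hd hc hs).2, (hg.2 _ hd hc hs).2, sub_self]
  filter_upwards [h] with x hx hxU
  exact sub_eq_zero.1 (hx hxU)

theorem beta_eq {m q : ℕ} (hm : 1 ≤ m) (hmq : m ≤ q) :
    beta m q =
      ((2 ^ ((m ^ 2 + m) / 2)
          / (4 * Real.pi ^ m * ∏ j ∈ Finset.Icc 1 (m - 1), (Nat.factorial j : ℝ))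
        * ∫ x in chamber m (2 * m - q),
            calI hm q x * vandermonde x * (∏ j, |x j|) * Real.exp (-∑ j, x j) : ℝ) : ℂ) := by
  have hf := isXiIntegralOn_chamber hm hmq
  have hU := isOpen_chamber m (2 * m - q)
  have hae := (show IsXiIntegralOn (chamber m (2 * m - q)) (xiIntegral (chamber m (2 * m - q))) from
    Classical.epsilon_spec ⟨_, hf⟩).ae_eq hU hf
  have hint : ∫ x in chamber m (2 * m - q),
        (vandermonde x : ℂ) * ((∏ j, |x j| : ℝ) : ℂ) * xiIntegral (chamber m (2 * m - q)) x
      = Complex.I ^ (m * (m - 1) / 2) * 2 ^ (m * (m + 1) / 2) * (Real.pi : ℂ) ^ m *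
        ((∫ x in chamber m (2 * m - q),
          calI hm q x * vandermonde x * (∏ j, |x j|) * Real.exp (-∑ j, x j) : ℝ) : ℂ) := by
    rw [← integral_complex_ofReal, ← integral_const_mul]
    refine setIntegral_congr_ae hU.measurableSet ?_
    filter_upwards [hae] with x hx hxU
    rw [hx hxU]
    push_cast
    ring
  rw [beta, hint, show m ^ 2 + m = m * (m + 1) by ring]
  -- The phase in the definition of β cancels the phase of the ξ-integral.
  have hI : (-Complex.I) ^ (m * (m - 1) / 2) * Complex.I ^ (m * (m - 1) / 2) = 1 := by
    rw [← mul_pow, neg_mul, Complex.I_mul_I, neg_neg, one_pow]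
  have hpi : (Real.pi : ℂ) ≠ 0 := by exact_mod_cast Real.pi_ne_zero
  have hfact : (∏ j ∈ Finset.Icc 1 (m - 1), (Nat.factorial j : ℂ)) ≠ 0 :=
    Finset.prod_ne_zero_iff.2 fun j _ => by exact_mod_cast Nat.factorial_ne_zero j
  rw [Complex.ofReal_mul]
  generalize ((∫ x in chamber m (2 * m - q),
    calI hm q x * vandermonde x * (∏ j, |x j|) * Real.exp (-∑ j, x j) : ℝ) : ℂ) = J
  push_cast
  rw [two_mul m, pow_add]
  field_simp
  linear_combination J * hI

end DSZ

theorem lemma1p2 (m q : ℕ) (hm : 1 ≤ m) (hmq : m ≤ q) (hq : q ≤ 2 * m) :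
    -- the value of the distributional `ξ`-integrals on the chamber
    DSZ.IsXiIntegralOn (DSZ.chamber m (2 * m - q)) (fun x : Fin m → ℝ =>
      Complex.I ^ (m * (m - 1) / 2) * 2 ^ (m * (m + 1) / 2) * (Real.pi : ℂ) ^ m
        * ((DSZ.calI hm q x * Real.exp (-∑ j, x j) : ℝ) : ℂ)) ∧
    -- absolute convergence of the resulting integral, and the formula for `β_{2q}(m)`
    MeasureTheory.IntegrableOn (fun x : Fin m → ℝ =>
      DSZ.calI hm q x * DSZ.vandermonde x * (∏ j, |x j|) * Real.exp (-∑ j, x j))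
      (DSZ.chamber m (2 * m - q)) ∧
    DSZ.beta m q =
      ((2 ^ ((m ^ 2 + m) / 2)
          / (4 * Real.pi ^ m * ∏ j ∈ Finset.Icc 1 (m - 1), (Nat.factorial j : ℝ))
        * ∫ x in DSZ.chamber m (2 * m - q),
            DSZ.calI hm q x * DSZ.vandermonde x * (∏ j, |x j|) * Real.exp (-∑ j, x j) : ℝ) : ℂ) :=
  ⟨DSZ.isXiIntegralOn_chamber hm hmq, DSZ.integrableOn_calI hm hmq, DSZ.beta_eq hm hmq⟩
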